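/- Let $\Phi$ be an irreducible reduced root system, let $h$ be its Coxeter number and $h^\vee$ its dual Coxeter number, and let $k$ be a field whose characteristic is zero or at least $h+2$. Let $\mathfrak g$ be the Lie algebra of an absolutely simple linear algebraic group $G$ over $k$ with root system $\Phi$; equivalently, $\mathfrak g$ is a finite-dimensional Lie algebra over $k$ such that $\mathfrak g\otimes_k\overline k$ has a Chevalley basis of type $\Phi$. Write $K$ for the Killing form of $\mathfrak g$ and $T\bullet U=\frac12(TU+UT)$ for $T,U\in\operatorname{End}(\mathfrak g)$. For $X,Y\in\mathfrak g$ put $$S(X,Y)=h^\vee\,\operatorname{ad}X\bullet\operatorname{ad}Y+\tfrac12\bigl(X\otimes K(Y,\cdot)+Y\otimes K(X,\cdot)\bigr)\in\operatorname{End}(\mathfrak g),$$ let $A(\mathfrak g)\subseteq\operatorname{End}(\mathfrak g)$ be the linear span of all $S(X,Y)$, and equip $A(\mathfrak g)$ with the well-defined commutative bilinear product $\diamond$ determined by $$\begin{aligned}S(A,B)\diamond S(C,D)={}&\tfrac{h^\vee}2\bigl(S(A,(\operatorname{ad}C\bullet\operatorname{ad}D)B)+S((\operatorname{ad}C\bullet\operatorname{ad}D)A,B)\bigr)\\&+\tfrac{h^\vee}2\bigl(S(C,(\operatorname{ad}A\bullet\operatorname{ad}B)D)+S((\operatorname{ad}A\bullet\operatorname{ad}B)C,D)\bigr)\\&+\tfrac{h^\vee}2\bigl(S([A,C],[B,D])+S([A,D],[B,C])\bigr)\\&+\tfrac14\bigl(K(A,C)S(B,D)+K(A,D)S(B,C)\bigr)\\&+\tfrac14\bigl(K(B,C)S(A,D)+K(B,D)S(A,C)\bigr).\end{aligned}$$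 Put $\varepsilon=\frac1{\dim\mathfrak g}\operatorname{Tr}\colon A(\mathfrak g)\to k$ and $e=\operatorname{Id}_{\mathfrak g}$. For a vector space $V$ with a bilinear product $\cdot$ and a bilinear form $f$, let $\mathrm U(V,f)$ be the algebra $k\oplus V$ with product $$(x_0,x_1)(y_0,y_1)=(x_0y_0+f(x_1,y_1),\;x_0y_1+y_0x_1+x_1\cdot y_1).$$ An algebra is called power-associative if the subalgebra generated by any one element is associative. Assume that $\Phi$ is not of type $A_1$ or $A_2$. Then $e$ belongs to $A(\mathfrak g)$ and is an identity element for $\diamond$, $\varepsilon(e)=1$, and hence $A(\mathfrak g)=\mathrm U(V,f)$ for $V=\ker\varepsilon$ with $f(v,v')=\varepsilon(v\diamond v')$ and $v\cdot v'=v\diamond v'-f(v,v')e$. Moreover: 1. the multiplication $\cdot$ on $V$ is not zero; 2. neither $V$ nor $\mathrm U(V,cf)$ is power-associative, for any $c\in k$. -/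

import Mathlib

open scoped TensorProduct

noncomputable section

namespace ChayetGaribaldi

section RootSystems

variable {ι M N : Type*} [Finite ι] [AddCommGroup M] [Module ℚ M] [AddCommGroup N] [Module ℚ N]

/-- The Coxeter number `h = |Φ| / rank Φ` of an irreducible reduced root system; the quotient is an
integer, the order of a Coxeter element. -/
def coxeterNumber (P : RootPairing ι ℚ M N) : ℕ :=
  (Set.range P.root).ncard / Module.finrank ℚ M

variable {P : RootPairing ι ℚ M N}

/-- `θ` is the highest root with respect to the base `b`: for every root `α`, the difference
`θ - α` is a sum of simple roots. -/
def IsHighestRoot (b : P.Base) (θ : ι) : Prop :=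
  ∀ i : ι, P.root θ - P.root i ∈ AddSubmonoid.closure (P.root '' b.support)

/-- The dual Coxeter number `1 + ht(θ^∨)`, where `θ` is the highest root and the height of its
coroot `θ^∨ = ∑ cᵢ αᵢ^∨` is `∑ cᵢ`. -/
def dualCoxeterNumber (b : P.Base) (θ : ι) : ℤ :=
  1 + b.flip.height θ

variable [P.IsCrystallographic]

/-- The root system is of type `A_n`: its Cartan matrix is that of `A_n`, up to a numbering of the
simple roots. -/
def IsTypeA (b : P.Base) (n : ℕ) : Prop :=
  ∃ e : b.support ≃ Fin n, b.cartanMatrix.reindex e e = CartanMatrix.A n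

/-- A Chevalley basis of type `Φ` of a Lie algebra `L` over a field `K`: elements `h i`, one for
each simple root, and `x α`, one for each root, forming together a basis of `L`, that satisfy
Chevalley's relations. -/
structure ChevalleyBasis (b : P.Base) (K L : Type*) [Field K] [LieRing L] [LieAlgebra K L] where
  h : b.support → L
  x : ι → L
  basis : Module.Basis (b.support ⊕ ι) K L
  basis_inl : ∀ i, basis (Sum.inl i) = h i
  basis_inr : ∀ α, basis (Sum.inr α) = x α
  /-- The `h i` commute. -/
  lie_h_h : ∀ i j, ⁅h i, h j⁆ = 0
  /-- `[h i, x α] = ⟨α, αᵢ^∨⟩ x α`. -/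
  lie_h_x : ∀ (i : b.support) (α : ι), ⁅h i, x α⁆ = P.pairingIn ℤ α i • x α
  /-- `[x α, x (-α)] = h α`, where `h α = ∑ cᵢ h i` if `α^∨ = ∑ cᵢ αᵢ^∨`. -/
  lie_x_neg : ∀ α β : ι, P.root β = -P.root α → ∀ c : b.support → ℤ,
    P.coroot α = ∑ i, c i • P.coroot i → ⁅x α, x β⁆ = ∑ i, c i • h i
  /-- `[x α, x β] = ± (r + 1) x (α + β)` if `α + β` is a root, where `r` is the largest integer
  such that `β - r α` is a root. -/
  lie_x_x : ∀ α β γ : ι, P.root α + P.root β = P.root γ →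
    ⁅x α, x β⁆ = ((P.chainBotCoeff α β : ℤ) + 1) • x γ ∨
      ⁅x α, x β⁆ = -(((P.chainBotCoeff α β : ℤ) + 1) • x γ)
  /-- `[x α, x β] = 0` if `α + β` is neither zero nor a root. -/
  lie_x_x_eq_zero : ∀ α β : ι, P.root α + P.root β ≠ 0 →
    P.root α + P.root β ∉ Set.range P.root → ⁅x α, x β⁆ = 0

/-- A finite-dimensional Lie algebra over `k` is *absolutely simple of Chevalley type `Φ`* if over
the algebraic closure of `k` it has a Chevalley basis of type `Φ`, i.e., becomes isomorphic to the
split simple Lie algebra of type `Φ`. -/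
def IsAbsolutelyOfType (b : P.Base) (k 𝔤 : Type*) [Field k] [LieRing 𝔤] [LieAlgebra k 𝔤] : Prop :=
  Nonempty (ChevalleyBasis b (AlgebraicClosure k) (AlgebraicClosure k ⊗[k] 𝔤))

end RootSystems

section Algebra

variable (k : Type*) {𝔤 : Type*} [Field k] [LieRing 𝔤] [LieAlgebra k 𝔤]

/-- The Jordan product `T • U = (TU + UT) / 2` on endomorphisms. -/
def jordan (T U : Module.End k 𝔤) : Module.End k 𝔤 :=
  (2⁻¹ : k) • (T * U + U * T)

/-- The Jordan product of `ad X` and `ad Y`. -/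
def adJordan (X Y : 𝔤) : Module.End k 𝔤 :=
  jordan k (LieAlgebra.ad k 𝔤 X) (LieAlgebra.ad k 𝔤 Y)

/-- `P(XY) = (X ⊗ K(Y, -) + Y ⊗ K(X, -)) / 2`, for `K` the Killing form. -/
def symOp (X Y : 𝔤) : Module.End k 𝔤 :=
  (2⁻¹ : k) • ((killingForm k 𝔤 Y).smulRight X + (killingForm k 𝔤 X).smulRight Y)

/-- `S(XY) = c (ad X • ad Y) + P(XY)`, where the scalar `c` will be the dual Coxeter number. -/
def S (c : k) : 𝔤 →ₗ[k] 𝔤 →ₗ[k] Module.End k 𝔤 :=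
  LinearMap.mk₂ k (fun X Y => c • adJordan k X Y + symOp k X Y)
    (by intro X X' Y; ext Z; simp [adJordan, jordan, symOp]; module)
    (by intro a X Y; ext Z; simp [adJordan, jordan, symOp]; module)
    (by intro X Y Y'; ext Z; simp [adJordan, jordan, symOp]; module)
    (by intro a X Y; ext Z; simp [adJordan, jordan, symOp]; module)

variable (𝔤) in
/-- The space `A(𝔤) ⊆ End(𝔤)`, the image of `S` (which, being symmetric in `X` and `Y`, has the
same image on `𝔤 ⊗ 𝔤` as on `Sym² 𝔤`). -/
def algA (c : k) : Submodule k (Module.End k 𝔤) :=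
  LinearMap.range (TensorProduct.lift (S k (𝔤 := 𝔤) c))

/-- `S(XY)` as an element of `A(𝔤)`. -/
def SA (c : k) (X Y : 𝔤) : algA k 𝔤 c :=
  ⟨S k c X Y, X ⊗ₜ Y, by simp⟩

/-- The right-hand side of the formula for the product `S(XY) ⋄ S(ZW)`. -/
def prodFormula (c : k) (X Y Z W : 𝔤) : Module.End k 𝔤 :=
  (c / 2) • (S k c X (adJordan k Z W Y) + S k c (adJordan k Z W X) Y)
  + (c / 2) • (S k c Z (adJordan k X Y W) + S k c (adJordan k X Y Z) W)
  + (c / 2) • (S k c ⁅X, Z⁆ ⁅Y, W⁆ + S k c ⁅X, W⁆ ⁅Y, Z⁆)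
  + (4⁻¹ : k) • (killingForm k 𝔤 X Z • S k c Y W + killingForm k 𝔤 X W • S k c Y Z)
  + (4⁻¹ : k) • (killingForm k 𝔤 Y Z • S k c X W + killingForm k 𝔤 Y W • S k c X Z)

/-- The commutator `T ↦ [ad X, T]` on endomorphisms. -/
def adEnd : 𝔤 →ₗ[k] Module.End k (Module.End k 𝔤) :=
  LinearMap.mk₂ k (fun X T => LieAlgebra.ad k 𝔤 X * T - T * LieAlgebra.ad k 𝔤 X)
    (by intro X X' T; simp only [map_add]; noncomm_ring)
    (by intro a X T; simp [smul_sub])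
    (by intro X T U; noncomm_ring)
    (by intro a X T; simp [smul_sub])

/-- An auxiliary expression of the product, linear in `T = S(ZW)`. -/
def prodAux (c : k) (X Y : 𝔤) : Module.End k (Module.End k 𝔤) where
  toFun T := (2⁻¹ : k) • (S k c X (T Y) + S k c (T X) Y)
    + (c / 4) • (adEnd k X (adEnd k Y T) + adEnd k Y (adEnd k X T))
  map_add' T U := by simp only [LinearMap.add_apply, map_add]; module
  map_smul' a T := by
    simp only [LinearMap.smul_apply, map_smul, RingHom.id_apply]; module

def prodAux₂ (c : k) : 𝔤 →ₗ[k] 𝔤 →ₗ[k] Module.End k (Module.End k 𝔤) :=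
  LinearMap.mk₂ k (prodAux k c)
    (by intro X X' Y; ext1 T; simp [prodAux]; module)
    (by intro a X Y; ext1 T; simp [prodAux]; module)
    (by intro X Y Y'; ext1 T; simp [prodAux]; module)
    (by intro a X Y; ext1 T; simp [prodAux]; module)

theorem adEnd_S (c : k) (X Y Z : 𝔤) :
    adEnd k X (S k c Y Z) = S k c ⁅X, Y⁆ Z + S k c Y ⁅X, Z⁆ := by
  have hK (U V : 𝔤) : killingForm k 𝔤 ⁅X, U⁆ V = - killingForm k 𝔤 U ⁅X, V⁆ := by
    have := LieModule.traceForm_apply_lie_apply' k 𝔤 𝔤 X U V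
    simpa [killingForm] using this
  ext W
  simp only [adEnd, S, LinearMap.mk₂_apply, adJordan, jordan, symOp, Module.End.mul_apply,
    LinearMap.sub_apply, LinearMap.add_apply, LinearMap.smul_apply, LieAlgebra.ad_apply,
    LinearMap.smulRight_apply, hK, lie_add, lie_smul, lie_lie, lie_sub]
  module

theorem S_comm (c : k) (X Y : 𝔤) : S k c X Y = S k c Y X := by
  ext W
  simp [S, adJordan, jordan, symOp]
  module

theorem prodAux_S (c : k) (X Y Z W : 𝔤) :
    prodAux k c X Y (S k c Z W) = prodFormula k c X Y Z W := by
  by_cases h2 : (2 : k) = 0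
  · have h4 : (4 : k) = 0 := by rw [show (4 : k) = 2 * 2 by norm_num, h2, zero_mul]
    simp [prodAux, prodFormula, h2, h4]
  have h4 : (4 : k) ≠ 0 := by
    rw [show (4 : k) = 2 * 2 by norm_num]; exact mul_ne_zero h2 h2
  have hS (U : 𝔤) : S k c Z W U = c • adJordan k Z W U + symOp k Z W U := by simp [S]
  have hP (U : 𝔤) : symOp k Z W U =
      (2⁻¹ : k) • (killingForm k 𝔤 U W • Z + killingForm k 𝔤 U Z • W) := by
    simp [symOp, LieModule.traceForm_comm k 𝔤 𝔤 U]
  have hJ (U : 𝔤) : adJordan k X Y U = (2⁻¹ : k) • (⁅X, ⁅Y, U⁆⁆ + ⁅Y, ⁅X, U⁆⁆) := by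
    simp [adJordan, jordan]
  simp only [prodAux, prodFormula, LinearMap.coe_mk, AddHom.coe_mk, adEnd_S, map_add, hS, hP, hJ,
    map_smul, LinearMap.add_apply, LinearMap.smul_apply, S_comm k c Z Y, S_comm k c W Y,
    S_comm k c ⁅Y, Z⁆ ⁅X, W⁆]
  match_scalars <;> field_simp <;> ring

theorem prodFormula_comm (c : k) (X Y Z W : 𝔤) :
    prodFormula k c X Y Z W = prodFormula k c Z W X Y := by
  simp only [prodFormula, LieModule.traceForm_comm k 𝔤 𝔤 X, LieModule.traceForm_comm k 𝔤 𝔤 Y,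
    S_comm k c W Y, S_comm k c W X, S_comm k c Z Y, S_comm k c Z X,
    ← lie_skew X Z, ← lie_skew Y W, ← lie_skew X W, ← lie_skew Y Z, map_neg, LinearMap.neg_apply,
    neg_neg, S_comm k c ⁅Z, Y⁆ ⁅W, X⁆]
  module

theorem exists_algMul (c : k) : ∃ m : algA k 𝔤 c →ₗ[k] algA k 𝔤 c →ₗ[k] algA k 𝔤 c,
    ∀ X Y Z W : 𝔤, (m (SA k c X Y) (SA k c Z W) : Module.End k 𝔤) = prodFormula k c X Y Z W := by
  set T := TensorProduct.lift (S k (𝔤 := 𝔤) c) with hT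
  set G := TensorProduct.lift (prodAux₂ k (𝔤 := 𝔤) c) with hG
  have hsymm : ∀ t u, G t (T u) = G u (T t) := by
    intro t u
    induction t with
    | zero => simp
    | add t t' ht ht' => simp [ht, ht']
    | tmul X Y =>
      induction u with
      | zero => simp
      | add u u' hu hu' => simp [hu, hu']
      | tmul Z W =>
        simp only [hT, hG, TensorProduct.lift.tmul]
        change prodAux k c X Y _ = prodAux k c Z W _
        rw [prodAux_S, prodAux_S, prodFormula_comm]
  have hmem : ∀ t u, G t (T u) ∈ LinearMap.range T := by
    intro t u
    induction t with
    | zero => simp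
    | add t t' ht ht' => simpa using add_mem ht ht'
    | tmul X Y =>
      induction u with
      | zero => simp
      | add u u' hu hu' => simpa using add_mem hu hu'
      | tmul Z W =>
        have hS : ∀ U V : 𝔤, S k c U V ∈ LinearMap.range T := fun U V => ⟨U ⊗ₜ V, by simp [hT]⟩
        simp only [hT, hG, TensorProduct.lift.tmul]
        change prodAux k c X Y _ ∈ _
        rw [prodAux_S, prodFormula]
        refine add_mem (add_mem (add_mem (add_mem ?_ ?_) ?_) ?_) ?_ <;>
          refine Submodule.smul_mem _ _ (add_mem ?_ ?_) <;>
          first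
            | exact hS _ _
            | exact Submodule.smul_mem _ _ (hS _ _)
  obtain ⟨s, hs⟩ : ∃ s : algA k 𝔤 c →ₗ[k] 𝔤 ⊗[k] 𝔤, ∀ a, T (s a) = a := by
    obtain ⟨s, hs⟩ := LinearMap.exists_rightInverse_of_surjective T.rangeRestrict
      (LinearMap.range_eq_top.mpr T.surjective_rangeRestrict)
    exact ⟨s, fun a => congrArg Subtype.val (LinearMap.congr_fun hs a)⟩
  refine ⟨LinearMap.mk₂ k (fun a b : algA k 𝔤 c =>
      (⟨G (s a) b, by rw [← hs b]; exact hmem _ _⟩ : algA k 𝔤 c))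
    (fun _ _ _ => Subtype.ext (by simp)) (fun _ _ _ => Subtype.ext (by simp))
    (fun _ _ _ => Subtype.ext (by simp)) (fun _ _ _ => Subtype.ext (by simp)), ?_⟩
  intro X Y Z W
  have h1 : (SA k c Z W : Module.End k 𝔤) = T (Z ⊗ₜ W) := by simp [hT, SA]
  have h2 : T (s (SA k c X Y)) = T (X ⊗ₜ Y) := by rw [hs]; simp [hT, SA]
  change G (s (SA k c X Y)) (SA k c Z W : Module.End k 𝔤) = _
  rw [h1, hsymm, h2, hsymm]
  simp only [hT, hG, TensorProduct.lift.tmul]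
  exact prodAux_S k c X Y Z W

variable (𝔤) in
/-- The product `⋄` of `A(𝔤)`: the bilinear map given by `prodFormula` on the elements `S(XY)`. It
is determined by this since these elements span `A(𝔤)`. -/
def algMul (c : k) : algA k 𝔤 c →ₗ[k] algA k 𝔤 c →ₗ[k] algA k 𝔤 c :=
  (exists_algMul k (𝔤 := 𝔤) c).choose

theorem coe_algMul_SA (c : k) (X Y Z W : 𝔤) :
    (algMul k 𝔤 c (SA k c X Y) (SA k c Z W) : Module.End k 𝔤) = prodFormula k c X Y Z W :=
  (exists_algMul k (𝔤 := 𝔤) c).choose_spec X Y Z W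

variable (𝔤) in
/-- The counit `ε = (1 / dim 𝔤) Tr` of `A(𝔤)`. -/
def algCounit (c : k) : algA k 𝔤 c →ₗ[k] k :=
  (Module.finrank k 𝔤 : k)⁻¹ • (LinearMap.trace k 𝔤).comp (algA k 𝔤 c).subtype

end Algebra

section Unit

variable {k V : Type*} [Field k] [AddCommGroup V] [Module k V]

/-- The product of `Unit(V, f)` on `k ⊕ V`, where `V` has the product `m`:
`(x₀, x₁) (y₀, y₁) = (x₀ y₀ + f(x₁, y₁), x₀ y₁ + y₀ x₁ + x₁ y₁)`. -/
def unitMul (m : V →ₗ[k] V →ₗ[k] V) (f : V →ₗ[k] V →ₗ[k] k) :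
    (k × V) →ₗ[k] (k × V) →ₗ[k] (k × V) :=
  LinearMap.mk₂ k
    (fun x y => (x.1 * y.1 + f x.2 y.2, x.1 • y.2 + y.1 • x.2 + m x.2 y.2))
    (by intro x x' y; ext <;> simp <;> [ring; module])
    (by intro a x y; ext <;> simp <;> [ring; module])
    (by intro x y y'; ext <;> simp <;> [ring; module])
    (by intro a x y; ext <;> simp <;> [ring; module])

/-- The bilinear form `f(v, v') = ε(v v')` on the kernel of a linear form `ε` on an algebra. -/
def kerForm (m : V →ₗ[k] V →ₗ[k] V) (ε : V →ₗ[k] k) :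
    LinearMap.ker ε →ₗ[k] LinearMap.ker ε →ₗ[k] k :=
  (m.compr₂ ε).compl₁₂ (LinearMap.ker ε).subtype (LinearMap.ker ε).subtype

/-- The product `v · v' = v v' - f(v, v') e` on the kernel of `ε`, where `ε(e) = 1`. -/
def kerMul (m : V →ₗ[k] V →ₗ[k] V) (e : V) (ε : V →ₗ[k] k) (hε : ε e = 1) :
    LinearMap.ker ε →ₗ[k] LinearMap.ker ε →ₗ[k] LinearMap.ker ε :=
  LinearMap.mk₂ k (fun v w => ⟨m v w - ε (m v w) • e, by simp [hε]⟩)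
    (by intro v v' w; ext; simp; module)
    (by intro a v w; ext; simp; module)
    (by intro v w w'; ext; simp; module)
    (by intro a v w; ext; simp; module)

/-- The subalgebra generated by an element `a` of a (non-associative) algebra with product `m`. -/
def generatedSubalgebra {V : Type*} [AddCommMonoid V] [Module k V] (m : V →ₗ[k] V →ₗ[k] V) (a : V) : Submodule k V :=
  sInf {B | a ∈ B ∧ ∀ x ∈ B, ∀ y ∈ B, m x y ∈ B}

/-- An algebra is power-associative if the subalgebra generated by any element is associative. -/
def IsPowerAssociative {V : Type*} [AddCommMonoid V] [Module k V] (m : V →ₗ[k] V →ₗ[k] V) : Prop :=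
  ∀ a : V, ∀ x ∈ generatedSubalgebra m a, ∀ y ∈ generatedSubalgebra m a,
    ∀ z ∈ generatedSubalgebra m a, m (m x y) z = m x (m y z)

end Unit

end ChayetGaribaldi

end

open ChayetGaribaldi

noncomputable section

namespace ChayetGaribaldi

set_option linter.unusedSectionVars false

/-! ### The invariant operator `∑ α ⊗ α^∨` and the Coxeter number. -/

section RootSystemLemmas

variable {ι M N : Type*} [Fintype ι] [AddCommGroup M] [Module ℚ M] [AddCommGroup N] [Module ℚ N]

/-! Power-associativity forces `a² a² = (a² a) a`. For `a` in `V`, the `V`-component of this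
identity in `U(V, c₀ f)` says that `powerDefect` vanishes at `(a, a, a, a)`; the value `c₀ = 0`
gives the identity in `V` itself. Summing the defect over all permutations of four arguments gives a
multilinear identity, which passes from `V` to its extension to the algebraic closure, even over a
finite field. There a Chevalley basis is available, and it suffices to violate the identity.

Write `c = h^∨`. Let `(h₁, e₁, f₁)` be the `sl₂`-triple of the highest root `θ`, and `(h₂, e₂, f₂)`
that of a simple root orthogonal to `θ`, which exists outside `A₁` and `A₂`; the two triples
commute. Since `S(e₁ e₁) = 0`, the Killing form has `K(h₁, h₁) = 4c`, so `ω = S(h₁ h₁) / 4c` is an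
idempotent, with counit `δ = (c + 1) / dim 𝔤`. It has eigenvalue `1/2` on `a = S(e₁ e₂)`, `b = S(f₁
h₂)` and `n = S(h₁ e₂)`, and `0` on `u = S(e₂ h₂)`, while `a ⋄ b = (c/2) u - c n`. With `z = ω - δ
e`, the identity at `(z, z, a, b)` is a linear relation between `n` and `u`
(`smul_add_smul_eq_zero`). Evaluating it at `h₁` kills `u` and leaves `1/4 + (c₀ - 1)(δ - δ²) = 0`.
If `u ≠ 0`, the other coefficient gives `(c₀ - 1)(δ - δ²) = 0`, so `1/4 = 0`, which is absurd. If `u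
= 0`, then `S(h₂ h₂) / 4c` is a second idempotent, orthogonal to `ω`, and the identity at the
difference of the two forces `c₀ = 1`, absurd as before, or that their sum is `2δ e`. The latter is
refuted on a root vector, where it would make the square of a Cartan integer equal to `3`.

The identity element is the Casimir sum of the `S(xᵢ x'ᵢ)` over Killing-dual bases, divided by `c +
1`. Nondegeneracy of the Killing form is read off from the Chevalley basis. The bound on the
characteristic enters through `rank + 1 ≤ h^∨ ≤ h` and `dim 𝔤 = rank · (h + 1)`: they make `2`, `3`,
`h^∨`, `h^∨ + 1`, `h` and `dim 𝔤` invertible. -/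

/-- The endomorphism `x ↦ ∑ ⟨α, x⟩ α^∨` of the coweight space. -/
def corootSum (P : RootPairing ι ℚ M N) : Module.End ℚ N :=
  ∑ α, (P.root' α).smulRight (P.coroot α)

variable (P : RootPairing ι ℚ M N)

theorem corootSum_apply (x : N) : corootSum P x = ∑ α, P.root' α x • P.coroot α := by
  simp [corootSum]

theorem corootSum_coreflection (i : ι) (x : N) :
    corootSum P (P.coreflection i x) = P.coreflection i (corootSum P x) := by
  simp only [corootSum_apply, map_sum, map_smul]
  refine Fintype.sum_equiv (P.reflectionPerm i) _ _ fun α => ?_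
  have h1 : P.root' (P.reflectionPerm i α) x = P.root' α (P.coreflection i x) :=
    (P.flip.coroot'_reflection (i := i) (j := α) x).symm
  rw [h1, P.coroot_reflectionPerm, P.coreflection_same]

/-- A Schur argument: the operator commutes with reflections, so it preserves the `-1`-eigenline of
each one. Thus a coroot is an eigenvector, and its eigenspace, being invariant under the Weyl group,
is everything. -/
theorem exists_corootSum_eq_smul [P.IsIrreducible] : ∃ t : ℚ, ∀ x, corootSum P x = t • x := by
  have hN : Nontrivial N := RootPairing.IsIrreducible.nontrivial' P
  rcases isEmpty_or_nonempty ι with hι | ⟨⟨i⟩⟩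
  · exact ⟨0, fun x => by simp [corootSum_apply]⟩
  have h1 : corootSum P (P.coroot i) = (2⁻¹ * P.root' i (corootSum P (P.coroot i))) • P.coroot i := by
    have := corootSum_coreflection P i (P.coroot i)
    rw [P.coreflection_apply_self, map_neg, P.coreflection_apply] at this
    rw [mul_smul, eq_comm, inv_smul_eq_iff₀ two_ne_zero, two_smul]
    rw [eq_sub_iff_add_eq, neg_add_eq_iff_eq_add] at this
    exact this
  set t := 2⁻¹ * P.root' i (corootSum P (P.coroot i)) with ht
  refine ⟨t, ?_⟩
  have htop : LinearMap.ker (corootSum P - t • LinearMap.id) = ⊤ := by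
    refine RootPairing.IsIrreducible.eq_top_of_invtSubmodule_coreflection (P := P) _ ?_ ?_
    · intro j x hx
      simp only [LinearMap.mem_ker, LinearMap.sub_apply, LinearMap.smul_apply, LinearMap.id_apply,
        sub_eq_zero, Submodule.mem_comap, LinearEquiv.coe_coe] at hx ⊢
      rw [corootSum_coreflection, hx, map_smul]
    · refine (Submodule.ne_bot_iff _).mpr ⟨P.coroot i, ?_, P.flip.ne_zero i⟩
      simp [← h1]
  intro x
  have hx : x ∈ LinearMap.ker (corootSum P - t • LinearMap.id) := by rw [htop]; trivial
  simpa [sub_eq_zero] using hx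

theorem trace_corootSum [Module.Finite ℚ N] :
    LinearMap.trace ℚ N (corootSum P) = 2 * Fintype.card ι := by
  simp [corootSum, LinearMap.trace_smulRight, mul_comm]

variable {P}

/-- The coordinates of a coroot with respect to the simple coroots. -/
def corootCoeff (b : P.Base) (α : ι) (j : b.support) : ℤ :=
  (b.flip.exists_root_eq_sum_int α).choose j

theorem coroot_eq_sum (b : P.Base) (α : ι) :
    P.coroot α = ∑ j : b.support, corootCoeff b α j • P.coroot j := by
  have := (b.flip.exists_root_eq_sum_int α).choose_spec.2.2
  exact this.trans (Finset.sum_coe_sort b.support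
    (fun j => (b.flip.exists_root_eq_sum_int α).choose j • P.coroot j)).symm

theorem coroot_sum_inj (b : P.Base) {f g : b.support → ℚ}
    (h : ∑ j : b.support, f j • P.coroot j = ∑ j : b.support, g j • P.coroot j) : f = g := by
  have := Fintype.linearIndependent_iffₛ.mp b.linearIndepOn_coroot f g h
  exact funext this

theorem height_flip_eq (b : P.Base) (α : ι) :
    b.flip.height α = ∑ j : b.support, corootCoeff b α j :=
  (Finset.sum_coe_sort b.support (fun j => (b.flip.exists_root_eq_sum_int α).choose j)).symm

open Classical in
theorem sum_isPos_of_neg (b : P.Base) {V : Type*} [AddCommGroup V] [Module ℚ V] (F : ι → V)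
    (hF : ∀ α, F (P.reflectionPerm α α) = F α) :
    ∑ α, F α = (2 : ℚ) • ∑ α with b.IsPos α, F α := by
  rw [← Finset.sum_filter_add_sum_filter_not _ b.IsPos, two_smul]
  congr 1
  let := P.indexNeg
  refine Finset.sum_nbij' (fun α => -α) (fun α => -α) ?_ ?_ (fun α _ => neg_neg α)
    (fun α _ => neg_neg α) (fun α _ => (hF α).symm)
  · intro α hα
    rw [Finset.mem_filter] at hα ⊢
    exact ⟨Finset.mem_univ _, (RootPairing.Base.IsPos.neg_iff_not b α).mpr hα.2⟩
  · intro α hα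
    rw [Finset.mem_filter] at hα ⊢
    refine ⟨Finset.mem_univ _, ?_⟩
    rw [RootPairing.Base.IsPos.neg_iff_not b α]
    exact not_not.mpr hα.2

theorem finrank_eq_card_support [P.IsRootSystem] (b : P.Base) :
    Module.finrank ℚ M = Fintype.card b.support := by
  exact Module.finrank_eq_card_basis b.toWeightBasis

theorem finrank_eq_card_support' [P.IsRootSystem] (b : P.Base) :
    Module.finrank ℚ N = Fintype.card b.support :=
  Module.finrank_eq_card_basis b.toCoweightBasis

open Classical in
-- Each `α ⊗ α^∨` has trace `2`, so the scalar `t` of `corootSum` satisfies `t · rank = 2 |Φ|`, that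
-- is, `t = 2h`; positive roots contribute half. The diagonal coefficient is an integer, which shows
-- that the division in `coxeterNumber` is exact.
theorem card_eq_and_sum_pos [P.IsRootSystem] [P.IsCrystallographic] [P.IsIrreducible]
    (b : P.Base) :
    Fintype.card ι = Fintype.card b.support * coxeterNumber P ∧
    ∀ i j : b.support, ∑ α with b.IsPos α, P.pairingIn ℤ α i * corootCoeff b α j =
      if i = j then (coxeterNumber P : ℤ) else 0 := by
  have hM : Nontrivial M := RootPairing.IsIrreducible.nontrivial P
  have : Module.Finite ℚ M := Module.Finite.of_basis b.toWeightBasis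
  have : Module.Finite ℚ N := Module.Finite.of_basis b.toCoweightBasis
  obtain ⟨t, ht⟩ := exists_corootSum_eq_smul P
  have hpos : 0 < Fintype.card b.support := by
    rw [← finrank_eq_card_support b]; exact Module.finrank_pos
  have htr : 2 * (Fintype.card ι : ℚ) = t * Fintype.card b.support := by
    rw [← trace_corootSum P, ← finrank_eq_card_support' b]
    have : corootSum P = t • LinearMap.id := by ext x; simp [ht]
    rw [this]; simp [LinearMap.trace_id]
  have key (i j : b.support) : ((∑ α with b.IsPos α, P.pairingIn ℤ α i * corootCoeff b α j : ℤ) : ℚ)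
      = if i = j then t / 2 else 0 := by
    have h1 := ht (P.coroot i)
    rw [corootSum_apply, sum_isPos_of_neg b _ (by intro α; simp)] at h1
    have h2 : ∑ j : b.support, (∑ α with b.IsPos α, P.pairing α i * (corootCoeff b α j : ℚ)) • P.coroot j
        = ∑ j : b.support, (if i = j then t / 2 else 0 : ℚ) • P.coroot j := by
      have h3 : ∑ α with b.IsPos α, P.root' α (P.coroot i) • P.coroot α = (t / 2) • P.coroot i := by
        rw [div_eq_inv_mul, mul_smul, ← h1, inv_smul_smul₀ two_ne_zero]
      simp only [ite_smul, zero_smul, Finset.sum_ite_eq, Finset.mem_univ, if_true]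
      rw [← h3]
      simp only [Finset.sum_smul]
      rw [Finset.sum_comm]
      refine Finset.sum_congr rfl fun α _ => ?_
      conv_rhs => rw [coroot_eq_sum b α]
      simp only [Finset.smul_sum, mul_smul, Int.cast_smul_eq_zsmul]
      simp
    have h4 := congrFun (coroot_sum_inj b h2) j
    rw [← h4]
    push_cast
    refine Finset.sum_congr rfl fun α _ => ?_
    congr 1
    exact P.algebraMap_pairingIn ℤ α i
  obtain ⟨i⟩ := Fintype.card_pos_iff.mp hpos
  have hz := key i i
  rw [if_pos rfl] at hz
  set z := ∑ α with b.IsPos α, P.pairingIn ℤ α i * corootCoeff b α i with hzdef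
  have hcard : (Fintype.card ι : ℤ) = Fintype.card b.support * z := by
    have : (Fintype.card ι : ℚ) = Fintype.card b.support * z := by rw [hz]; linarith
    exact_mod_cast this
  have hcox : (coxeterNumber P : ℤ) = z := by
    have h5 : (Set.range P.root).ncard = Fintype.card ι := by
      rw [← Set.image_univ, Set.ncard_image_of_injective _ P.root.injective, Set.ncard_univ,
        Nat.card_eq_fintype_card]
    rw [coxeterNumber, h5, finrank_eq_card_support b]
    push_cast
    rw [hcard]
    exact Int.mul_ediv_cancel_left _ (by exact_mod_cast hpos.ne')
  refine ⟨by rw [← hcox] at hcard; exact_mod_cast hcard, fun i j => ?_⟩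
  have := key i j
  rw [← hz] at this
  rw [hcox]
  exact_mod_cast this

end RootSystemLemmas

/-! ### The highest root, the dual Coxeter number and lengths of roots. -/

section HighestRoot

variable {ι M N : Type*} [Fintype ι] [AddCommGroup M] [Module ℚ M] [AddCommGroup N] [Module ℚ N]
  {P : RootPairing ι ℚ M N}

/-- The coordinates of a root with respect to the simple roots. -/
def rootCoeff (b : P.Base) (α : ι) (j : b.support) : ℤ :=
  corootCoeff b.flip α j

theorem root_eq_sum (b : P.Base) (α : ι) :
    P.root α = ∑ j : b.support, rootCoeff b α j • P.root j :=
  coroot_eq_sum b.flip α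

theorem height_eq (b : P.Base) (α : ι) : b.height α = ∑ j : b.support, rootCoeff b α j :=
  height_flip_eq b.flip α

theorem repr_root [P.IsRootSystem] (b : P.Base) (α : ι) (j : b.support) :
    b.toWeightBasis.repr (P.root α) j = rootCoeff b α j := by
  classical
  conv_lhs => rw [root_eq_sum b α]
  simp [Finsupp.single_apply, ← Int.cast_smul_eq_zsmul ℚ]

theorem repr_nonneg [P.IsRootSystem] (b : P.Base) {x : M}
    (hx : x ∈ AddSubmonoid.closure (P.root '' b.support)) (j : b.support) :
    0 ≤ b.toWeightBasis.repr x j := by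
  classical
  induction hx using AddSubmonoid.closure_induction with
  | mem x hx =>
    obtain ⟨i, hi, rfl⟩ := hx
    have := b.toWeightBasis_repr_root ⟨i, hi⟩
    simp only at this
    rw [this, Finsupp.single_apply]
    split_ifs <;> norm_num
  | zero => simp
  | add x y _ _ hx hy => simpa using add_nonneg hx hy

theorem eq_zero_of_mem_closure [P.IsRootSystem] (b : P.Base) {x : M}
    (hx : x ∈ AddSubmonoid.closure (P.root '' b.support))
    (hx' : -x ∈ AddSubmonoid.closure (P.root '' b.support)) : x = 0 := by
  refine b.toWeightBasis.ext_elem fun j => ?_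
  have h1 := repr_nonneg b hx j
  have h2 := repr_nonneg b hx' j
  simp only [map_neg, Finsupp.neg_apply] at h2
  simp only [map_zero, Finsupp.zero_apply]
  linarith

theorem rootCoeff_nonneg [P.IsRootSystem] (b : P.Base) {α : ι}
    (hα : P.root α ∈ AddSubmonoid.closure (P.root '' b.support)) (j : b.support) :
    0 ≤ rootCoeff b α j := by
  have := repr_nonneg b hα j
  rw [repr_root] at this
  exact_mod_cast this

/-- Reconciles positivity by height with membership in the cone of simple roots; the cone is what
`IsHighestRoot` speaks of. The forward direction holds because `α` and `-α` are not both positive.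
-/
theorem isPos_iff_mem_closure [P.IsRootSystem] (b : P.Base) (α : ι) :
    b.IsPos α ↔ P.root α ∈ AddSubmonoid.closure (P.root '' b.support) := by
  have key : ∀ β, P.root β ∈ AddSubmonoid.closure (P.root '' b.support) → b.IsPos β := by
    intro β hβ
    rw [RootPairing.Base.isPos_iff', height_eq]
    exact Finset.sum_nonneg fun j _ => rootCoeff_nonneg b hβ j
  refine ⟨fun h => ?_, key α⟩
  refine (b.root_mem_or_neg_mem α).resolve_right fun h' => ?_
  let := P.indexNeg
  have := key (-α) (by simpa using h')
  exact (RootPairing.Base.IsPos.neg_iff_not b α).mp this h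

theorem pairingIn_eq_sum_right [P.IsCrystallographic] (b : P.Base) (α β : ι) :
    P.pairingIn ℤ α β = ∑ i : b.support, corootCoeff b β i * P.pairingIn ℤ α i := by
  refine (algebraMap ℤ ℚ).injective_int ?_
  rw [P.algebraMap_pairingIn, ← P.root_coroot_eq_pairing]
  conv_lhs => rw [coroot_eq_sum b β]
  simp [map_sum, ← Int.cast_smul_eq_zsmul ℚ, ← P.algebraMap_pairingIn ℤ]

theorem pairingIn_eq_sum_left [P.IsCrystallographic] (b : P.Base) (α β : ι) :
    P.pairingIn ℤ α β = ∑ i : b.support, rootCoeff b α i * P.pairingIn ℤ i β := by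
  refine (algebraMap ℤ ℚ).injective_int ?_
  rw [P.algebraMap_pairingIn, ← P.root_coroot_eq_pairing]
  conv_lhs => rw [root_eq_sum b α]
  simp [map_sum, ← Int.cast_smul_eq_zsmul ℚ, ← P.algebraMap_pairingIn ℤ]

variable [P.IsRootSystem] [P.IsCrystallographic] [P.IsReduced]
  {b : P.Base} {θ : ι}

theorem isPos_highestRoot (hθ : IsHighestRoot b θ) : b.IsPos θ := by
  rw [isPos_iff_mem_closure]
  refine (b.root_mem_or_neg_mem θ).resolve_right fun h => P.ne_zero θ ?_
  have h1 := hθ (P.reflectionPerm θ θ)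
  simp only [RootPairing.root_reflectionPerm, RootPairing.reflection_apply_self, sub_neg_eq_add] at h1
  refine eq_zero_of_mem_closure b ?_ h
  have := add_mem h1 h
  simpa using this

theorem eq_of_two_le_pairingIn (hθ : IsHighestRoot b θ) {α : ι} (h : 2 ≤ P.pairingIn ℤ α θ) :
    α = θ := by
  have hpos := (isPos_iff_mem_closure b θ).mp (isPos_highestRoot hθ)
  obtain ⟨m, hm⟩ := Int.eq_ofNat_of_zero_le (sub_nonneg.mpr h)
  have hm' : P.pairing α θ = m + 2 := by
    rw [← P.algebraMap_pairingIn ℤ, show P.pairingIn ℤ α θ = m + 2 by lia]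
    simp
  have h1 := hθ α
  have h2 : m • P.root θ ∈ AddSubmonoid.closure (P.root '' b.support) := nsmul_mem hpos m
  -- The root used is `-s_θ(α) = (m + 2) θ - α`. It lies below `θ`, so `α - (m + 1) θ` is in the
  -- cone; adding `m θ` gives `α - θ`.
  have h3 := hθ (P.reflectionPerm (P.reflectionPerm θ α) (P.reflectionPerm θ α))
  rw [RootPairing.root_reflectionPerm, RootPairing.reflection_apply_self,
    RootPairing.root_reflectionPerm, RootPairing.reflection_apply_root, hm'] at h3
  have h4 : P.root θ - P.root α = 0 := by
    refine eq_zero_of_mem_closure b h1 ?_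
    convert add_mem h2 h3 using 1
    rw [← Nat.cast_smul_eq_nsmul ℚ]
    module
  exact (P.root.injective (sub_eq_zero.mp h4)).symm

theorem pairingIn_nonneg_of_isPos (hθ : IsHighestRoot b θ) {α : ι} (hα : b.IsPos α) :
    0 ≤ P.pairingIn ℤ α θ := by
  by_contra! h
  have hα' := (isPos_iff_mem_closure b α).mp hα
  obtain ⟨γ, hγ⟩ := P.root_add_root_mem_of_pairingIn_neg h (by
    intro h'
    refine P.ne_zero α (eq_zero_of_mem_closure b hα' ?_)
    rw [h', neg_neg]
    exact (isPos_iff_mem_closure b θ).mp (isPos_highestRoot hθ))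
  refine P.ne_zero α (eq_zero_of_mem_closure b hα' ?_)
  have := hθ γ
  rwa [hγ, show P.root θ - (P.root α + P.root θ) = - P.root α by abel] at this

theorem pairingIn_eq_zero_or_one (hθ : IsHighestRoot b θ) {α : ι} (hα : b.IsPos α) (hne : α ≠ θ) :
    P.pairingIn ℤ α θ = 0 ∨ P.pairingIn ℤ α θ = 1 := by
  have h1 := pairingIn_nonneg_of_isPos hθ hα
  have h2 : ¬ 2 ≤ P.pairingIn ℤ α θ := fun h => hne (eq_of_two_le_pairingIn hθ h)
  lia

open Classical in
-- The simple reflection permutes the positive roots other than its own, reversing the sign of the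
-- pairing; only the simple root itself contributes.
theorem sum_isPos_pairingIn_simple (i : b.support) :
    ∑ α with b.IsPos α, P.pairingIn ℤ α i = 2 := by
  have hi : b.IsPos i := b.isPos_of_mem_support i.2
  rw [← Finset.add_sum_erase _ _ (Finset.mem_filter.mpr ⟨Finset.mem_univ _, hi⟩),
    RootPairing.pairingIn_same]
  have hinv : ∀ α, P.reflectionPerm (i : ι) (P.reflectionPerm i α) = α := by simp
  suffices h : ∑ α ∈ (Finset.univ.filter b.IsPos).erase (i : ι), P.pairingIn ℤ α i
      = ∑ α ∈ (Finset.univ.filter b.IsPos).erase (i : ι), -P.pairingIn ℤ α i by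
    rw [Finset.sum_neg_distrib] at h
    lia
  have hmem : ∀ α ∈ (Finset.univ.filter b.IsPos).erase (i : ι),
      P.reflectionPerm i α ∈ (Finset.univ.filter b.IsPos).erase (i : ι) := by
    intro α hα
    rw [Finset.mem_erase, Finset.mem_filter] at hα ⊢
    refine ⟨fun h => ?_, Finset.mem_univ _, hα.2.2.reflectionPerm i.2 hα.1⟩
    have h1 : α = P.reflectionPerm i i :=
      (hinv α).symm.trans (congrArg (P.reflectionPerm (i : ι)) h)
    let := P.indexNeg
    have h2 : b.IsPos (-(i : ι)) := by rw [h1] at hα; exact hα.2.2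
    exact (RootPairing.Base.IsPos.neg_iff_not b (i : ι)).mp h2 hi
  refine Finset.sum_nbij' (P.reflectionPerm i) (P.reflectionPerm i) hmem hmem
    (fun α _ => hinv α) (fun α _ => hinv α) ?_
  intro α _
  rw [← P.pairingIn_reflectionPerm]
  simp

open Classical in
theorem sum_isPos_pairingIn (β : ι) :
    ∑ α with b.IsPos α, P.pairingIn ℤ α β = 2 * b.flip.height β := by
  simp_rw [pairingIn_eq_sum_right b _ β]
  rw [Finset.sum_comm, height_flip_eq, Finset.mul_sum]
  refine Finset.sum_congr rfl fun i _ => ?_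
  rw [← Finset.mul_sum, sum_isPos_pairingIn_simple, mul_comm]

open Classical in
-- Apart from `θ` the pairings are `0` or `1`, hence equal to their squares. Replacing squares by
-- pairings changes only the term of `θ`, from `4` to `2`, in a sum equal to `2 ht(θ^∨)`.
theorem sum_isPos_pairingIn_sq (hθ : IsHighestRoot b θ) :
    ∑ α with b.IsPos α, P.pairingIn ℤ α θ ^ 2 = 2 * dualCoxeterNumber b θ := by
  have hmem : θ ∈ Finset.univ.filter b.IsPos :=
    Finset.mem_filter.mpr ⟨Finset.mem_univ _, isPos_highestRoot hθ⟩
  have h := sum_isPos_pairingIn (b := b) θ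
  rw [← Finset.add_sum_erase _ _ hmem, RootPairing.pairingIn_same] at h
  rw [← Finset.add_sum_erase _ _ hmem, RootPairing.pairingIn_same, dualCoxeterNumber]
  have : ∑ α ∈ (Finset.univ.filter b.IsPos).erase θ, P.pairingIn ℤ α θ ^ 2
      = ∑ α ∈ (Finset.univ.filter b.IsPos).erase θ, P.pairingIn ℤ α θ := by
    refine Finset.sum_congr rfl fun α hα => ?_
    rw [Finset.mem_erase, Finset.mem_filter] at hα
    rcases pairingIn_eq_zero_or_one hθ hα.2.2 hα.1 with h | h <;> rw [h] <;> norm_num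
  rw [this]
  lia

theorem sum_pairingIn_sq (hθ : IsHighestRoot b θ) :
    ∑ α, P.pairingIn ℤ α θ ^ 2 = 4 * dualCoxeterNumber b θ := by
  classical
  have h1 := sum_isPos_of_neg b (fun α => ((P.pairingIn ℤ α θ ^ 2 : ℤ) : ℚ)) (by
    intro α; simp)
  have h2 := sum_isPos_pairingIn_sq hθ
  rw [← Int.cast_sum, ← Int.cast_sum, h2, smul_eq_mul] at h1
  have : ∑ α, P.pairingIn ℤ α θ ^ 2 = 2 * (2 * dualCoxeterNumber b θ) := by exact_mod_cast h1
  lia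

open Classical in
theorem sum_isPos_pairingIn_mul [P.IsIrreducible] (β γ : ι) :
    ∑ α with b.IsPos α, P.pairingIn ℤ α β * P.pairingIn ℤ γ α
      = coxeterNumber P * P.pairingIn ℤ γ β := by
  have h := (card_eq_and_sum_pos b).2
  calc _ = ∑ α with b.IsPos α, ∑ i : b.support, ∑ j : b.support,
        corootCoeff b β i * P.pairingIn ℤ γ j * (P.pairingIn ℤ α i * corootCoeff b α j) := by
        refine Finset.sum_congr rfl fun α _ => ?_
        rw [pairingIn_eq_sum_right b α β, pairingIn_eq_sum_right b γ α, Finset.sum_mul_sum]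
        refine Finset.sum_congr rfl fun i _ => Finset.sum_congr rfl fun j _ => ?_
        ring
    _ = ∑ i : b.support, ∑ j : b.support, corootCoeff b β i * P.pairingIn ℤ γ j *
          ∑ α with b.IsPos α, P.pairingIn ℤ α i * corootCoeff b α j := by
        rw [Finset.sum_comm]
        refine Finset.sum_congr rfl fun i _ => ?_
        rw [Finset.sum_comm]
        refine Finset.sum_congr rfl fun j _ => ?_
        rw [Finset.mul_sum]
    _ = _ := by
        simp only [h, mul_ite, mul_zero, Finset.sum_ite_eq, Finset.mem_univ, if_true]
        rw [pairingIn_eq_sum_right b γ β, Finset.mul_sum]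
        exact Finset.sum_congr rfl fun i _ => by ring

/-- Compares termwise `∑ ⟨α, θ^∨⟩² = 2h^∨` with `∑ ⟨α, θ^∨⟩⟨θ, α^∨⟩ = 2h` over positive roots: where
`⟨α, θ^∨⟩ = 1`, the reverse pairing is at least `1`. -/
theorem dualCoxeterNumber_le [P.IsIrreducible] (hθ : IsHighestRoot b θ) :
    dualCoxeterNumber b θ ≤ coxeterNumber P := by
  classical
  have h1 := sum_isPos_pairingIn_sq hθ
  have h2 := sum_isPos_pairingIn_mul (b := b) θ θ
  rw [RootPairing.pairingIn_same] at h2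
  have h3 : ∑ α with b.IsPos α, P.pairingIn ℤ α θ ^ 2 ≤
      ∑ α with b.IsPos α, P.pairingIn ℤ α θ * P.pairingIn ℤ θ α := by
    refine Finset.sum_le_sum fun α hα => ?_
    rcases eq_or_ne α θ with rfl | hne
    · rw [sq]
    rcases pairingIn_eq_zero_or_one hθ (Finset.mem_filter.mp hα).2 hne with h | h
    · rw [h]; norm_num
    · have := (P.zero_lt_pairingIn_iff' ℤ (i := α) (j := θ)).mp (by rw [h]; norm_num)
      rw [h]
      lia
  lia

theorem one_le_rootCoeff (hθ : IsHighestRoot b θ) (j : b.support) : 1 ≤ rootCoeff b θ j := by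
  have := repr_nonneg b (hθ j) j
  rw [map_sub, Finsupp.sub_apply, repr_root, b.toWeightBasis_repr_root, Finsupp.single_eq_same,
    sub_nonneg] at this
  exact_mod_cast this

/-- In terms of the invariant form, `(θ, θ) θ^∨ = ∑ mᵢ (αᵢ, αᵢ) αᵢ^∨` when `θ = ∑ mᵢ αᵢ`, so
positivity of the `mᵢ` carries over to the coroot. -/
theorem one_le_corootCoeff (hθ : IsHighestRoot b θ) (j : b.support) : 1 ≤ corootCoeff b θ j := by
  have hpos (α : ι) : 0 < P.RootForm (P.root α) (P.root α) :=
    P.rootForm_pos_of_ne_zero (Submodule.subset_span ⟨α, rfl⟩) (P.ne_zero α)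
  have h1 : ∑ i : b.support, (P.RootForm (P.root θ) (P.root θ) * corootCoeff b θ i) • P.coroot i
      = ∑ i : b.support, (rootCoeff b θ i * P.RootForm (P.root i) (P.root i)) • P.coroot i := by
    calc _ = P.RootForm (P.root θ) (P.root θ) • P.coroot θ := by
          conv_rhs => rw [coroot_eq_sum b θ]
          simp only [Finset.smul_sum, mul_smul, Int.cast_smul_eq_zsmul]
      _ = 2 • P.Polarization (P.root θ) := P.rootForm_self_smul_coroot θ
      _ = ∑ i : b.support, (rootCoeff b θ i : ℚ) • (2 • P.Polarization (P.root i)) := by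
          conv_lhs => rw [root_eq_sum b θ]
          rw [map_sum, Finset.smul_sum]
          refine Finset.sum_congr rfl fun i _ => ?_
          rw [map_zsmul, Int.cast_smul_eq_zsmul, smul_comm]
      _ = _ := by
          refine Finset.sum_congr rfl fun i _ => ?_
          rw [← P.rootForm_self_smul_coroot, mul_smul]
  have h2 := congrFun (coroot_sum_inj b h1) j
  have h3 : (0 : ℚ) < rootCoeff b θ j * P.RootForm (P.root j) (P.root j) :=
    mul_pos (by exact_mod_cast one_le_rootCoeff hθ j) (hpos j)
  rw [← h2] at h3
  have := (mul_pos_iff_of_pos_left (hpos θ)).mp h3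
  exact_mod_cast this

theorem card_support_lt_dualCoxeterNumber (hθ : IsHighestRoot b θ) :
    Fintype.card b.support + 1 ≤ dualCoxeterNumber b θ := by
  rw [dualCoxeterNumber, height_flip_eq, add_comm]
  have := Finset.card_nsmul_le_sum Finset.univ (corootCoeff b θ) 1
    (fun j _ => one_le_corootCoeff hθ j)
  simpa using this

theorem one_le_pairingIn_of_ne_zero (hθ : IsHighestRoot b θ) (i : b.support)
    (h : P.pairingIn ℤ θ i ≠ 0) : 1 ≤ P.pairingIn ℤ i θ ∧ 1 ≤ P.pairingIn ℤ θ i := by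
  have h1 := pairingIn_nonneg_of_isPos hθ (b.isPos_of_mem_support i.2)
  have h2 : 0 < P.pairingIn ℤ i θ := by
    refine lt_of_le_of_ne h1 fun h' => h ?_
    exact P.pairingIn_eq_zero_iff.mp h'.symm
  exact ⟨h2, (P.zero_lt_pairingIn_iff' ℤ).mp h2⟩

theorem isTypeA_one_of_card (h : Fintype.card b.support = 1) : IsTypeA b 1 := by
  refine ⟨Fintype.equivFinOfCardEq h, ?_⟩
  ext x y
  obtain rfl : x = y := Subsingleton.elim _ _
  simp [CartanMatrix.A]

theorem two_le_card_support (hA₁ : ¬ IsTypeA b 1) [P.IsIrreducible] :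
    2 ≤ Fintype.card b.support := by
  have hM : Nontrivial M := RootPairing.IsIrreducible.nontrivial P
  have : Module.Finite ℚ M := Module.Finite.of_basis b.toWeightBasis
  have h1 : 0 < Fintype.card b.support := by
    rw [← finrank_eq_card_support b]; exact Module.finrank_pos
  have h2 : Fintype.card b.support ≠ 1 := fun h => hA₁ (isTypeA_one_of_card h)
  lia

/-- Outside types `A₁` and `A₂` some simple root is orthogonal to the highest root. -/
theorem exists_simple_orthogonal [P.IsIrreducible] (hθ : IsHighestRoot b θ)
    (hA₁ : ¬ IsTypeA b 1) (hA₂ : ¬ IsTypeA b 2) :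
    ∃ j : b.support, P.pairingIn ℤ θ j = 0 := by
  by_contra! hne
  have hc := two_le_card_support hA₁
  have h1 i := one_le_pairingIn_of_ne_zero hθ i (hne i)
  have h2 := pairingIn_eq_sum_right b θ θ
  rw [RootPairing.pairingIn_same] at h2
  have h3 := pairingIn_eq_sum_left b θ θ
  rw [RootPairing.pairingIn_same] at h3
  -- In `2 = ∑ cᵢ ⟨θ, αᵢ^∨⟩` every term is at least `1`, so the rank is at most `2`. In rank `2` all
  -- coefficients and pairings must then be `1`, which determines the Cartan matrix.
  have hcard : Fintype.card b.support = 2 := by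
    have := Finset.card_nsmul_le_sum Finset.univ
      (fun i : b.support => corootCoeff b θ i * P.pairingIn ℤ θ i) 1
      (fun i _ => one_le_mul_of_one_le_of_one_le (one_le_corootCoeff hθ i) (h1 i).2)
    rw [← h2] at this
    simp only [Finset.card_univ, nsmul_eq_mul, mul_one] at this
    lia
  set e := Fintype.equivFinOfCardEq hcard
  refine hA₂ ⟨e, ?_⟩
  have hsum (f : b.support → ℤ) : ∑ i, f i = f (e.symm 0) + f (e.symm 1) := by
    rw [← e.symm.sum_comp, Fin.sum_univ_two]
  rw [hsum] at h2 h3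
  have hm0 := one_le_rootCoeff hθ (e.symm 0)
  have hm1 := one_le_rootCoeff hθ (e.symm 1)
  have hc0 := one_le_corootCoeff hθ (e.symm 0)
  have hc1 := one_le_corootCoeff hθ (e.symm 1)
  have hp0 := h1 (e.symm 0)
  have hp1 := h1 (e.symm 1)
  have m0 : rootCoeff b θ (e.symm 0) = 1 := by nlinarith
  have m1 : rootCoeff b θ (e.symm 1) = 1 := by nlinarith
  have p0 : P.pairingIn ℤ θ (e.symm 0) = 1 := by nlinarith
  have p1 : P.pairingIn ℤ θ (e.symm 1) = 1 := by nlinarith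
  have q0 := pairingIn_eq_sum_left b θ (e.symm 0)
  have q1 := pairingIn_eq_sum_left b θ (e.symm 1)
  rw [hsum, m0, m1, RootPairing.pairingIn_same, p0] at q0
  rw [hsum, m0, m1, RootPairing.pairingIn_same, p1] at q1
  have r0 : P.pairingIn ℤ (e.symm 1) (e.symm 0) = -1 := by lia
  have r1 : P.pairingIn ℤ (e.symm 0) (e.symm 1) = -1 := by lia
  ext x y
  fin_cases x <;> fin_cases y <;>
    simp [CartanMatrix.A, RootPairing.Base.cartanMatrix, RootPairing.Base.cartanMatrixIn_def, r0, r1]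

theorem exists_simple_pairingIn_eq_one [P.IsIrreducible] (hθ : IsHighestRoot b θ)
    (hA₁ : ¬ IsTypeA b 1) : ∃ i : b.support, P.pairingIn ℤ i θ = 1 := by
  have hc := two_le_card_support hA₁
  obtain ⟨i, hi⟩ : ∃ i : b.support, P.pairingIn ℤ i θ ≠ 0 := by
    by_contra! h
    have := pairingIn_eq_sum_left b θ θ
    simp [h] at this
  refine ⟨i, (pairingIn_eq_zero_or_one hθ (b.isPos_of_mem_support i.2) ?_).resolve_left hi⟩
  -- A simple highest root would have height `1`, whereas its coefficients are all at least `1` and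
  -- the rank is at least `2`.
  rintro rfl
  have h1 := Finset.card_nsmul_le_sum Finset.univ (rootCoeff b (i : ι)) 1
    (fun j _ => one_le_rootCoeff hθ j)
  rw [← height_eq, b.height_one_of_mem_support i.2] at h1
  simp only [Finset.card_univ, nsmul_eq_mul, mul_one] at h1
  lia

theorem add_notMem_range_root (hθ : IsHighestRoot b θ) {α : ι} (hα : b.IsPos α) :
    P.root θ + P.root α ∉ Set.range P.root := by
  rintro ⟨γ, hγ⟩
  have := hθ γ
  rw [hγ, sub_add_cancel_left] at this
  exact P.ne_zero α (eq_zero_of_mem_closure b ((isPos_iff_mem_closure b α).mp hα) this)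

/-- By orthogonality the reflection in `α` exchanges `θ - α` and `θ + α`, and the latter lies above
`θ`. -/
theorem sub_notMem_range_root (hθ : IsHighestRoot b θ) {α : ι} (hα : b.IsPos α)
    (h : P.pairingIn ℤ θ α = 0) : P.root θ - P.root α ∉ Set.range P.root := by
  rintro ⟨γ, hγ⟩
  refine add_notMem_range_root hθ hα ⟨P.reflectionPerm α γ, ?_⟩
  have h' : P.pairing θ α = 0 := by rw [← P.algebraMap_pairingIn ℤ, h]; simp
  rw [P.root_reflectionPerm, hγ, map_sub, P.reflection_apply_self, P.reflection_apply_root, h']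
  module

/-- If `2 θ + β` is a root, then `β = -θ`. -/
theorem eq_neg_of_two_add_mem (hθ : IsHighestRoot b θ) {β γ : ι}
    (h : P.root γ = P.root θ + (P.root θ + P.root β)) : P.root θ + P.root β = 0 := by
  have h1 := hθ γ
  have h2 := hθ (P.reflectionPerm β β)
  rw [h, sub_add_cancel_left] at h1
  rw [P.root_reflectionPerm, P.reflection_apply_self, sub_neg_eq_add] at h2
  exact eq_zero_of_mem_closure b h2 h1

variable (P) in
/-- The value at `α^∨` of the form `∑ ⟨β, ·⟩²` on the coweight space. -/
def sumSq (α : ι) : ℤ := ∑ β, P.pairingIn ℤ β α ^ 2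

theorem coe_sumSq (α : ι) :
    (sumSq P α : ℚ) = P.flip.toInvariantForm.form (P.flip.root α) (P.flip.root α) := by
  rw [RootPairing.toInvariantForm_form, P.flip.rootForm_root_self, sumSq]
  push_cast
  refine Finset.sum_congr rfl fun β _ => ?_
  rw [sq]
  congr 1 <;> exact P.algebraMap_pairingIn ℤ β α

theorem sumSq_mul_pairingIn (α β : ι) :
    sumSq P α * P.pairingIn ℤ α β = sumSq P β * P.pairingIn ℤ β α := by
  have h := P.flip.toInvariantForm.pairing_mul_eq_pairing_mul_swap α β
  rw [← coe_sumSq, ← coe_sumSq] at h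
  have h1 : P.flip.pairing β α = P.pairingIn ℤ α β := (P.algebraMap_pairingIn ℤ α β).symm
  have h2 : P.flip.pairing α β = P.pairingIn ℤ β α := (P.algebraMap_pairingIn ℤ β α).symm
  rw [h1, h2] at h
  have h' : P.pairingIn ℤ α β * sumSq P α = P.pairingIn ℤ β α * sumSq P β := by exact_mod_cast h
  rw [mul_comm, h', mul_comm]

/-- With `sumSq_mul_pairingIn`, this reduces the nonvanishing of `sumSq` modulo the characteristic
to the case of `θ`, where the value is `4h^∨`. -/
theorem exists_sumSq_eq_and_pairingIn_ne_zero [P.IsIrreducible] (α θ : ι) :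
    ∃ β, sumSq P β = sumSq P θ ∧ P.pairingIn ℤ β α ≠ 0 := by
  obtain ⟨β, h1, h2⟩ := P.flip.exists_form_eq_form_and_form_ne_zero P.flip.toInvariantForm α θ
  refine ⟨β, ?_, fun h => h2 ?_⟩
  · rw [← coe_sumSq, ← coe_sumSq] at h1
    exact_mod_cast h1
  · rw [RootPairing.InvariantForm.apply_root_root_zero_iff]
    have h3 : P.flip.pairing α β = P.pairingIn ℤ β α := (P.algebraMap_pairingIn ℤ β α).symm
    rw [h3, h, Int.cast_zero]

end HighestRoot

/-! ### Polarization of the fourth power identity. -/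

section Polarization

variable {K E : Type*} [Field K] [AddCommGroup E] [Module K E]

/-- The product `x y - ε(x y) e` on an algebra with a linear form `ε` and a distinguished
element `e`. -/
def reducedMul (m : E →ₗ[K] E →ₗ[K] E) (e : E) (ε : E →ₗ[K] K) : E →ₗ[K] E →ₗ[K] E :=
  m - (m.compr₂ ε).compr₂ (LinearMap.toSpanSingleton K E e)

theorem reducedMul_apply (m : E →ₗ[K] E →ₗ[K] E) (e : E) (ε : E →ₗ[K] K) (x y : E) :
    reducedMul m e ε x y = m x y - ε (m x y) • e := by
  simp [reducedMul]

/-- The quadrilinear defect of fourth power associativity in `U(V, c f)`, where `V` has the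
product `m` and `f` is a bilinear form. -/
def powerDefect (m : E →ₗ[K] E →ₗ[K] E) (f : E →ₗ[K] E →ₗ[K] K) (c : K) (x y z w : E) : E :=
  m (m x y) (m z w) - m (m (m x y) z) w - c • (f (m x y) z • w - f x y • m z w)

/-- The sum of a function of four variables over all permutations of its arguments. -/
def symmetrize {E W : Type*} [AddCommGroup W] (F : E → E → E → E → W) (x y z w : E) : W :=
  (F x y z w + F x y w z + F x z y w + F x z w y + F x w y z + F x w z y)
  + (F y x z w + F y x w z + F y z x w + F y z w x + F y w x z + F y w z x)
  + (F z x y w + F z x w y + F z y x w + F z y w x + F z w x y + F z w y x)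
  + (F w x y z + F w x z y + F w y x z + F w y z x + F w z x y + F w z y x)

/-- Inclusion-exclusion over subsets of the four arguments. Only additivity is used and nothing is
divided by, so diagonal vanishing on an additive submonoid suffices. -/
theorem symmetrize_eq_sum_diag {E W : Type*} [AddCommGroup E] [AddCommGroup W]
    (F : E → E → E → E → W)
    (h₁ : ∀ x x' y z w, F (x + x') y z w = F x y z w + F x' y z w)
    (h₂ : ∀ x y y' z w, F x (y + y') z w = F x y z w + F x y' z w)
    (h₃ : ∀ x y z z' w, F x y (z + z') w = F x y z w + F x y z' w)
    (h₄ : ∀ x y z w w', F x y z (w + w') = F x y z w + F x y z w') (G : E → W)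
    (hG : ∀ x, G x = F x x x x) (x y z w : E) :
    symmetrize F x y z w =
      G (x + y + z + w) - G (x + y + z) - G (x + y + w) - G (x + z + w) - G (y + z + w)
      + G (x + y) + G (x + z) + G (x + w) + G (y + z) + G (y + w) + G (z + w)
      - G x - G y - G z - G w := by
  simp only [symmetrize, hG, h₁, h₂, h₃, h₄]
  abel

theorem symmetrize_powerDefect_eq_zero_of_diag (m : E →ₗ[K] E →ₗ[K] E) (f : E →ₗ[K] E →ₗ[K] K)
    (c : K) (Λ : AddSubmonoid E) (hΛ : ∀ x ∈ Λ, powerDefect m f c x x x x = 0)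
    {x y z w : E} (hx : x ∈ Λ) (hy : y ∈ Λ) (hz : z ∈ Λ) (hw : w ∈ Λ) :
    symmetrize (powerDefect m f c) x y z w = 0 := by
  rw [symmetrize_eq_sum_diag (powerDefect m f c) ?_ ?_ ?_ ?_
    (fun x => powerDefect m f c x x x x) (fun _ => rfl)]
  · have hxy := add_mem hx hy
    have hxz := add_mem hx hz
    have hyz := add_mem hy hz
    simp only [hΛ _ (add_mem (add_mem hxy hz) hw), hΛ _ (add_mem hxy hz), hΛ _ (add_mem hxy hw),
      hΛ _ (add_mem hxz hw), hΛ _ (add_mem hyz hw), hΛ _ hxy, hΛ _ hxz, hΛ _ (add_mem hx hw),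
      hΛ _ hyz, hΛ _ (add_mem hy hw), hΛ _ (add_mem hz hw), hΛ _ hx, hΛ _ hy, hΛ _ hz, hΛ _ hw,
      sub_zero, add_zero]
  all_goals
    intros
    simp only [powerDefect, map_add, LinearMap.add_apply, add_smul, smul_add, smul_sub]
    abel

/-- The polarized identity is linear in each argument, so it extends from `Λ` to its span, which the
diagonal identity itself need not do. Invariance under rotation reduces this to linearity in the
first argument. -/
theorem symmetrize_powerDefect_eq_zero_of_span (m : E →ₗ[K] E →ₗ[K] E) (f : E →ₗ[K] E →ₗ[K] K)
    (c : K) (Λ : AddSubmonoid E) (hΛ : ∀ x ∈ Λ, powerDefect m f c x x x x = 0) {x y z w : E}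
    (hx : x ∈ Submodule.span K (Λ : Set E)) (hy : y ∈ Submodule.span K (Λ : Set E))
    (hz : z ∈ Submodule.span K (Λ : Set E)) (hw : w ∈ Submodule.span K (Λ : Set E)) :
    symmetrize (powerDefect m f c) x y z w = 0 := by
  have hadd (x x' y z w : E) : symmetrize (powerDefect m f c) (x + x') y z w =
      symmetrize (powerDefect m f c) x y z w + symmetrize (powerDefect m f c) x' y z w := by
    simp only [symmetrize, powerDefect, map_add, LinearMap.add_apply, add_smul, smul_add, smul_sub]
    abel
  have hsmul (a : K) (x y z w : E) : symmetrize (powerDefect m f c) (a • x) y z w =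
      a • symmetrize (powerDefect m f c) x y z w := by
    simp only [symmetrize, powerDefect, map_smul, LinearMap.smul_apply, smul_eq_mul, mul_smul,
      smul_add, smul_sub, smul_comm _ a]
  have hrot (x y z w : E) : symmetrize (powerDefect m f c) x y z w =
      symmetrize (powerDefect m f c) y z w x := by
    simp only [symmetrize]
    abel
  have step {y z w : E} (h : ∀ x ∈ Λ, symmetrize (powerDefect m f c) x y z w = 0) {x : E}
      (hx : x ∈ Submodule.span K (Λ : Set E)) : symmetrize (powerDefect m f c) x y z w = 0 := by
    induction hx using Submodule.span_induction with
    | mem x hx => exact h x hx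
    | zero => simpa using hsmul 0 0 y z w
    | add x x' _ _ h h' => rw [hadd, h, h', add_zero]
    | smul a x _ h => rw [hsmul, h, smul_zero]
  refine step (fun x hx => ?_) hx
  rw [hrot]
  refine step (fun y hy => ?_) hy
  rw [hrot]
  refine step (fun z hz => ?_) hz
  rw [hrot]
  refine step (fun w hw => ?_) hw
  exact symmetrize_powerDefect_eq_zero_of_diag m f c Λ hΛ hw hx hy hz

end Polarization

/-! ### The product, trace and counit on the operators `S(XY)`. -/

section Operators

variable {k 𝔤 : Type*} [Field k] [LieRing 𝔤] [LieAlgebra k 𝔤] (c : k)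

theorem S_apply (X Y Z : 𝔤) : S k c X Y Z = (c / 2) • (⁅X, ⁅Y, Z⁆⁆ + ⁅Y, ⁅X, Z⁆⁆) +
    (2⁻¹ : k) • (killingForm k 𝔤 Y Z • X + killingForm k 𝔤 X Z • Y) := by
  simp [S, adJordan, jordan, symOp, smul_smul, div_eq_mul_inv]

/-- `S(XY)` as an element of `A(𝔤)`, bilinearly in `X` and `Y`. -/
def SAₗ : 𝔤 →ₗ[k] 𝔤 →ₗ[k] algA k 𝔤 c :=
  LinearMap.mk₂ k (SA k c) (fun X X' Y => Subtype.ext (by simp [SA]))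
    (fun a X Y => Subtype.ext (by simp [SA])) (fun X Y Y' => Subtype.ext (by simp [SA]))
    (fun a X Y => Subtype.ext (by simp [SA]))

theorem coe_SAₗ (X Y : 𝔤) : (SAₗ c X Y : Module.End k 𝔤) = S k c X Y := rfl

theorem algA_induction {p : algA k 𝔤 c → Prop} (hS : ∀ X Y, p (SAₗ c X Y))
    (hadd : ∀ a b, p a → p b → p (a + b)) (a : algA k 𝔤 c) : p a := by
  obtain ⟨_, t, rfl⟩ := a
  induction t with
  | zero =>
    convert hS 0 0
    simp
  | tmul X Y => exact hS X Y
  | add t u ht hu =>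
    convert hadd _ _ ht hu
    exact Subtype.ext (map_add (TensorProduct.lift (S k c)) t u)

/-- Makes multiplication by `S(XY)` computable from the operator `T` alone, with no need to write
`T` as a sum of generators. -/
theorem coe_algMul_S (X Y : 𝔤) (T : algA k 𝔤 c) :
    (algMul k 𝔤 c (SAₗ c X Y) T : Module.End k 𝔤) = prodAux k c X Y T := by
  induction T using algA_induction with
  | hS Z W =>
    rw [coe_SAₗ, prodAux_S]
    exact coe_algMul_SA k c X Y Z W
  | hadd a b ha hb => rw [map_add, Submodule.coe_add, ha, hb, Submodule.coe_add, map_add]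

theorem algMul_comm (a b : algA k 𝔤 c) : algMul k 𝔤 c a b = algMul k 𝔤 c b a := by
  induction a using algA_induction with
  | hadd a a' h h' => simp [h, h']
  | hS X Y =>
    induction b using algA_induction with
    | hadd b b' h h' => simp [h, h']
    | hS Z W =>
      apply Subtype.ext
      exact (coe_algMul_SA k c X Y Z W).trans ((prodFormula_comm k c X Y Z W).trans
        (coe_algMul_SA k c Z W X Y).symm)

theorem trace_S [FiniteDimensional k 𝔤] (h2 : (2 : k) ≠ 0) (X Y : 𝔤) :
    LinearMap.trace k 𝔤 (S k c X Y) = (c + 1) * killingForm k 𝔤 X Y := by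
  have h1 : LinearMap.trace k 𝔤 (LieAlgebra.ad k 𝔤 X * LieAlgebra.ad k 𝔤 Y) = killingForm k 𝔤 X Y :=
    rfl
  have h1' : LinearMap.trace k 𝔤 (LieAlgebra.ad k 𝔤 Y * LieAlgebra.ad k 𝔤 X) = killingForm k 𝔤 X Y := by
    rw [LinearMap.trace_mul_comm, h1]
  simp only [S, LinearMap.mk₂_apply, adJordan, jordan, symOp, map_add, map_smul, h1, h1',
    LinearMap.trace_smulRight, LieModule.traceForm_comm k 𝔤 𝔤 Y X, smul_eq_mul]
  field_simp
  ring

theorem algCounit_S [FiniteDimensional k 𝔤] (h2 : (2 : k) ≠ 0) (X Y : 𝔤) :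
    algCounit k 𝔤 c (SAₗ c X Y) = (c + 1) / Module.finrank k 𝔤 * killingForm k 𝔤 X Y := by
  have := trace_S c h2 X Y
  simp only [algCounit, LinearMap.smul_apply, LinearMap.comp_apply, Submodule.subtype_apply,
    coe_SAₗ, this, smul_eq_mul]
  ring

theorem killingForm_lie_left (X Y Z : 𝔤) :
    killingForm k 𝔤 ⁅X, Y⁆ Z = killingForm k 𝔤 X ⁅Y, Z⁆ :=
  LieModule.traceForm_apply_lie_apply k 𝔤 𝔤 X Y Z

end Operators

/-! ### Killing form values on an `sl₂`-triple. -/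

section Sl2

variable {k 𝔤 : Type*} [Field k] [LieRing 𝔤] [LieAlgebra k 𝔤] {h e f : 𝔤}

theorem lie_h_e' (t : IsSl2Triple h e f) : ⁅h, e⁆ = (2 : k) • e := by
  rw [t.lie_h_e_nsmul, two_nsmul, two_smul]

theorem lie_h_f' (t : IsSl2Triple h e f) : ⁅h, f⁆ = -((2 : k) • f) := by
  rw [t.lie_h_f_nsmul, two_nsmul, two_smul]

theorem lie_e_h' (t : IsSl2Triple h e f) : ⁅e, h⁆ = -((2 : k) • e) := by
  rw [← lie_skew, lie_h_e' (k := k) t]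

theorem lie_f_h' (t : IsSl2Triple h e f) : ⁅f, h⁆ = (2 : k) • f := by
  rw [← lie_skew, lie_h_f' (k := k) t, neg_neg]

theorem lie_f_e' (t : IsSl2Triple h e f) : ⁅f, e⁆ = -h := by
  rw [← lie_skew, t.lie_e_f]

theorem killingForm_h_h (t : IsSl2Triple h e f) :
    killingForm k 𝔤 h h = 2 * killingForm k 𝔤 e f := by
  conv_lhs => rw [← t.lie_e_f, killingForm_lie_left, t.lie_e_f, lie_f_h' (k := k) t]
  simp

theorem killingForm_h_e (h2 : (2 : k) ≠ 0) (t : IsSl2Triple h e f) : killingForm k 𝔤 h e = 0 := by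
  have := killingForm_lie_left (k := k) h h e
  rw [lie_self, lie_h_e' (k := k) t] at this
  simpa [h2] using this

theorem killingForm_h_f (h2 : (2 : k) ≠ 0) (t : IsSl2Triple h e f) : killingForm k 𝔤 h f = 0 := by
  have := killingForm_lie_left (k := k) h h f
  rw [lie_self, lie_h_f' (k := k) t] at this
  simpa [h2] using this

/-- Evaluate `S(e e)` at `f`: the result is `(K(e, f) - 2c) e`. -/
theorem killingForm_e_f_eq (h2 : (2 : k) ≠ 0) (t : IsSl2Triple h e f) (he : e ≠ 0) {c : k}
    (hS : S k c e e = 0) : killingForm k 𝔤 e f = 2 * c := by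
  have h1 : S k c e e f = 0 := by rw [hS]; simp
  rw [S_apply, t.lie_e_f, lie_e_h' (k := k) t] at h1
  have h3 : (killingForm k 𝔤 e f - 2 * c) • e = 0 := by
    rw [← h1]
    match_scalars
    field_simp
    ring
  exact sub_eq_zero.mp ((smul_eq_zero.mp h3).resolve_right he)

end Sl2

/-- Two commuting `sl₂`-triples. -/
structure CommutingSl2 {𝔤 : Type*} [LieRing 𝔤] (h₁ e₁ f₁ h₂ e₂ f₂ : 𝔤) : Prop where
  t₁ : IsSl2Triple h₁ e₁ f₁
  t₂ : IsSl2Triple h₂ e₂ f₂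
  h₁_h₂ : ⁅h₁, h₂⁆ = 0
  h₁_e₂ : ⁅h₁, e₂⁆ = 0
  h₁_f₂ : ⁅h₁, f₂⁆ = 0
  e₁_h₂ : ⁅e₁, h₂⁆ = 0
  e₁_e₂ : ⁅e₁, e₂⁆ = 0
  e₁_f₂ : ⁅e₁, f₂⁆ = 0
  f₁_h₂ : ⁅f₁, h₂⁆ = 0
  f₁_e₂ : ⁅f₁, e₂⁆ = 0
  f₁_f₂ : ⁅f₁, f₂⁆ = 0

/-! ### Idempotents and eigenvectors from two commuting triples. -/

section Config

variable {k 𝔤 : Type*} [Field k] [LieRing 𝔤] [LieAlgebra k 𝔤]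

/-- The element `S(HH) / 4c` for `H` the semisimple element of an `sl₂`-triple. -/
def omegaH (c : k) (H : 𝔤) : algA k 𝔤 c := (4 * c)⁻¹ • SAₗ c H H

theorem coe_algMul_omegaH (h2 : (2 : k) ≠ 0) (c : k) (H : 𝔤) (T : algA k 𝔤 c) :
    (algMul k 𝔤 c (omegaH c H) T : Module.End k 𝔤) = (4 * c)⁻¹ • (S k c H ((T : Module.End k 𝔤) H)
      + (c / 2) • adEnd k H (adEnd k H T)) := by
  rw [omegaH, map_smul, LinearMap.smul_apply, Submodule.coe_smul, coe_algMul_S]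
  congr 1
  simp only [prodAux, LinearMap.coe_mk, AddHom.coe_mk, S_comm k c ((T : Module.End k 𝔤) H) H]
  have h4 : (4 : k) = 2 * 2 := by norm_num
  rw [← two_smul k, ← two_smul k, smul_smul, smul_smul, inv_mul_cancel₀ h2, one_smul]
  congr 2
  rw [h4]
  field_simp

/-- If `ad H` acts on `X` by `0` or `± 2` and commutes with `Y`, then `S(HH) / 4c` acts by `1/2`
on `S(XY)`. -/
theorem algMul_omegaH_eigen (h2 : (2 : k) ≠ 0) {c : k} (hc : c ≠ 0) {H X Y : 𝔤}
    (hX : ⁅H, ⁅H, X⁆⁆ = (4 : k) • X) (hY : ⁅H, Y⁆ = 0) (hXY : ⁅X, Y⁆ = 0)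
    (hKX : killingForm k 𝔤 H X = 0) (hKY : killingForm k 𝔤 H Y = 0) :
    algMul k 𝔤 c (omegaH c H) (SAₗ c X Y) = (2⁻¹ : k) • SAₗ c X Y := by
  apply Subtype.ext
  have hYH : ⁅Y, H⁆ = 0 := by rw [← lie_skew, hY, neg_zero]
  have hYX : ⁅Y, X⁆ = 0 := by rw [← lie_skew, hXY, neg_zero]
  have h4 : (4 : k) = 2 * 2 := by norm_num
  have h3 : ⁅Y, ⁅X, H⁆⁆ = 0 := by
    rw [leibniz_lie, hYX, hYH]; simp
  rw [coe_algMul_omegaH h2, coe_SAₗ, S_apply, hYH, h3, LieModule.traceForm_comm k 𝔤 𝔤 X H,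
    LieModule.traceForm_comm k 𝔤 𝔤 Y H]
  change killingForm k 𝔤 H X = 0 at hKX
  change killingForm k 𝔤 H Y = 0 at hKY
  rw [show LieModule.traceForm k 𝔤 𝔤 H X = 0 from hKX,
    show LieModule.traceForm k 𝔤 𝔤 H Y = 0 from hKY]
  simp only [adEnd_S, hY, map_zero, add_zero, hX, map_smul, LinearMap.smul_apply, lie_zero,
    zero_smul, smul_zero, zero_add, Submodule.coe_smul, coe_SAₗ, smul_smul]
  congr 1
  rw [h4]
  field_simp

theorem algMul_omegaH_of_comm (h2 : (2 : k) ≠ 0) (c : k) {H X Y : 𝔤} (hX : ⁅H, X⁆ = 0)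
    (hY : ⁅H, Y⁆ = 0) (hKX : killingForm k 𝔤 H X = 0) (hKY : killingForm k 𝔤 H Y = 0) :
    algMul k 𝔤 c (omegaH c H) (SAₗ c X Y) = 0 := by
  apply Subtype.ext
  have hYH : ⁅Y, H⁆ = 0 := by rw [← lie_skew, hY, neg_zero]
  have hXH : ⁅X, H⁆ = 0 := by rw [← lie_skew, hX, neg_zero]
  rw [coe_algMul_omegaH h2, coe_SAₗ, S_apply, hYH, hXH, LieModule.traceForm_comm k 𝔤 𝔤 X H,
    LieModule.traceForm_comm k 𝔤 𝔤 Y H, show LieModule.traceForm k 𝔤 𝔤 H X = 0 from hKX,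
    show LieModule.traceForm k 𝔤 𝔤 H Y = 0 from hKY]
  simp [adEnd_S, hX, hY]

/-- Here the adjoint part of the product vanishes, and the eigenvalue comes from `S(H Y) H = 2c Y`.
-/
theorem algMul_omegaH_SAₗ (h2 : (2 : k) ≠ 0) {c : k} (hc : c ≠ 0) {H Y : 𝔤}
    (hY : ⁅H, Y⁆ = 0) (hKY : killingForm k 𝔤 H Y = 0) (hH : killingForm k 𝔤 H H = 4 * c) :
    algMul k 𝔤 c (omegaH c H) (SAₗ c H Y) = (2⁻¹ : k) • SAₗ c H Y := by
  apply Subtype.ext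
  have hYH : ⁅Y, H⁆ = 0 := by rw [← lie_skew, hY, neg_zero]
  have h4 : (4 : k) = 2 * 2 := by norm_num
  rw [coe_algMul_omegaH h2, coe_SAₗ, S_apply, hYH,
    LieModule.traceForm_comm k 𝔤 𝔤 Y H, show LieModule.traceForm k 𝔤 𝔤 H Y = 0 from hKY, hH]
  simp only [adEnd_S, hY, map_zero, add_zero, map_smul, LinearMap.zero_apply, lie_zero, lie_self,
    zero_smul, smul_zero, zero_add, Submodule.coe_smul, coe_SAₗ, smul_smul]
  congr 1
  rw [h4]
  field_simp

/-- The normalization `K(H, H) = 4c` makes `S(H H) / 4c` fix `H`, and `ad H` kills it. -/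
theorem algMul_omegaH_self (h2 : (2 : k) ≠ 0) {c : k} (hc : c ≠ 0) {H : 𝔤}
    (hH : killingForm k 𝔤 H H = 4 * c) :
    algMul k 𝔤 c (omegaH c H) (omegaH c H) = omegaH c H := by
  apply Subtype.ext
  have h4 : (4 : k) ≠ 0 := by
    rw [show (4 : k) = 2 * 2 by norm_num]; exact mul_ne_zero h2 h2
  rw [coe_algMul_omegaH h2]
  simp only [omegaH, Submodule.coe_smul, coe_SAₗ, LinearMap.smul_apply, S_apply, hH, map_smul,
    adEnd_S, lie_self, map_zero, LinearMap.zero_apply, add_zero, smul_zero, lie_zero, zero_add,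
    smul_smul, ← add_smul]
  congr 1
  field_simp
  norm_num

/-- The factors are chosen so that their product has components in two different eigenspaces of the
idempotent of `h₁`: `S(e₂ h₂)` for `0` and `S(h₁ e₂)` for `1/2`. -/
theorem algMul_SAₗ_SAₗ (h2 : (2 : k) ≠ 0) {c : k} {h₁ e₁ f₁ h₂ e₂ f₂ : 𝔤}
    (C : CommutingSl2 h₁ e₁ f₁ h₂ e₂ f₂) (he₁ : killingForm k 𝔤 e₁ f₁ = 2 * c)
    (hf₁e₂ : killingForm k 𝔤 f₁ e₂ = 0) (he₁h₂ : killingForm k 𝔤 e₁ h₂ = 0) :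
    algMul k 𝔤 c (SAₗ c e₁ e₂) (SAₗ c f₁ h₂) = (c / 2) • SAₗ c e₂ h₂ - c • SAₗ c h₁ e₂ := by
  apply Subtype.ext
  have h4 : (4 : k) = 2 * 2 := by norm_num
  have he₂h₂ : killingForm k 𝔤 h₂ e₂ = 0 := killingForm_h_e h2 C.t₂
  have hf₁e₁ : killingForm k 𝔤 f₁ e₁ = 2 * c := by rw [← he₁]; exact LieModule.traceForm_comm k 𝔤 𝔤 _ _
  have hh₂e₁ : killingForm k 𝔤 h₂ e₁ = 0 := by rw [← he₁h₂]; exact LieModule.traceForm_comm k 𝔤 𝔤 _ _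
  have s1 : ⁅e₂, f₁⁆ = 0 := by rw [← lie_skew, C.f₁_e₂, neg_zero]
  have s2 : ⁅h₂, e₁⁆ = 0 := by rw [← lie_skew, C.e₁_h₂, neg_zero]
  have s3 : ⁅h₂, f₁⁆ = 0 := by rw [← lie_skew, C.f₁_h₂, neg_zero]
  have s4 : ⁅h₂, h₁⁆ = 0 := by rw [← lie_skew, C.h₁_h₂, neg_zero]
  have s5 : ⁅e₂, h₁⁆ = 0 := by rw [← lie_skew, C.h₁_e₂, neg_zero]
  have T1 : S k c f₁ h₂ e₁ = c • h₂ := by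
    rw [S_apply, s2, lie_f_e' C.t₁, hh₂e₁, hf₁e₁, lie_zero, lie_neg, s4]
    match_scalars
    · simp
    · field_simp
  have T2 : S k c f₁ h₂ e₂ = 0 := by
    rw [S_apply, lie_h_e' (k := k) C.t₂, C.f₁_e₂, lie_smul, C.f₁_e₂, he₂h₂, hf₁e₂]
    simp
  rw [coe_algMul_S]
  simp only [prodAux, LinearMap.coe_mk, AddHom.coe_mk, coe_SAₗ, T1, T2, adEnd_S, C.t₁.lie_e_f, s1,
    lie_e_h' (k := k) C.t₂, C.e₁_h₂, C.e₁_e₂, s5, add_zero,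
    zero_add, map_zero, map_neg, map_smul, LinearMap.zero_apply, LinearMap.smul_apply,
    Submodule.coe_sub, Submodule.coe_smul, S_comm k c h₂ e₂]
  match_scalars
  · field_simp
  · rw [h4]
    field_simp
    norm_num

end Config

/-! ### The polarized identity evaluated from a multiplication table. -/

section Table

variable {K E : Type*} [Field K] [AddCommGroup E] [Module K E]

/-- With `z` used twice, and `a`, `b` once, every product that occurs reduces to the action of `z`
on its eigenvectors and the single product `a b`, so this short table determines all `24` terms. -/
theorem symmetrize_powerDefect_of_table (m : E →ₗ[K] E →ₗ[K] E) (f : E →ₗ[K] E →ₗ[K] K)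
    {c₀ σ δ φ p q : K} {z a b n u : E} (hm : ∀ x y, m x y = m y x) (hf : ∀ x y, f x y = f y x)
    (hzz : m z z = (2 * σ) • z) (hza : m z a = σ • a) (hzb : m z b = σ • b)
    (hab : m a b = p • u + q • n) (hzn : m z n = σ • n) (hzu : m z u = -(δ • u))
    (fzz : f z z = φ) (fza : f z a = 0) (fzb : f z b = 0) (fab : f a b = 0) (fzn : f z n = 0)
    (fzu : f z u = 0) :
    symmetrize (powerDefect m f c₀) z z a b =
      (4 * (σ ^ 2 + c₀ * φ) * q) • n + (4 * (-2 * σ * δ - δ ^ 2 + c₀ * φ) * p) • u := by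
  simp only [symmetrize, powerDefect, hm a z, hm b z, hm b a, hf a z, hf b z, hf b a, hzz, hza, hzb,
    hab, hzn, hzu, map_smul, map_add, LinearMap.smul_apply, LinearMap.add_apply, fzz, fza, fzb, fab,
    fzn, fzu, hf n z, hf u z, hm n z, hm u z, smul_zero, zero_smul, add_zero, map_neg,
    LinearMap.neg_apply]
  module

end Table

/-! ### The identity fails for a suitable pair of commuting triples. -/

section Contradiction

variable {k 𝔤 : Type*} [Field k] [LieRing 𝔤] [LieAlgebra k 𝔤] [FiniteDimensional k 𝔤]

theorem killingForm_comm (X Y : 𝔤) : killingForm k 𝔤 X Y = killingForm k 𝔤 Y X :=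
  LieModule.traceForm_comm k 𝔤 𝔤 X Y

/-- In an `sl₂`-triple, `h = [e, f]` is orthogonal to the centralizer of `f`. -/
theorem killingForm_h_eq_zero {h e f Y : 𝔤} (t : IsSl2Triple h e f) (hY : ⁅f, Y⁆ = 0) :
    killingForm k 𝔤 h Y = 0 := by
  rw [← t.lie_e_f, killingForm_lie_left, hY, map_zero]

theorem killingForm_f_eq_zero (h2 : (2 : k) ≠ 0) {h e f Y : 𝔤} (t : IsSl2Triple h e f)
    (hY : ⁅h, Y⁆ = 0) : killingForm k 𝔤 f Y = 0 := by
  have := killingForm_lie_left (k := k) f h Y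
  rw [hY, map_zero, lie_f_h' (k := k) t] at this
  simpa [h2] using this

theorem killingForm_e_eq_zero (h2 : (2 : k) ≠ 0) {h e f Y : 𝔤} (t : IsSl2Triple h e f)
    (hY : ⁅h, Y⁆ = 0) : killingForm k 𝔤 e Y = 0 := by
  have := killingForm_lie_left (k := k) e h Y
  rw [hY, map_zero, lie_e_h' (k := k) t] at this
  simpa [h2] using this

variable {c c₀ : k} {h₁ e₁ f₁ h₂ e₂ f₂ : 𝔤}

/-- The fourth power identity at `z, z, a, b`, for `z` the projection of the idempotent `omegaH c h₁`
to the kernel of the counit, `a = S(e₁ e₂)` and `b = S(f₁ h₂)`. -/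
theorem smul_add_smul_eq_zero (h2 : (2 : k) ≠ 0) (hc : c ≠ 0) (C : CommutingSl2 h₁ e₁ f₁ h₂ e₂ f₂)
    (he₁ : killingForm k 𝔤 e₁ f₁ = 2 * c) (he : (1 : Module.End k 𝔤) ∈ algA k 𝔤 c)
    (hunit : ∀ a, algMul k 𝔤 c ⟨1, he⟩ a = a) (hε : algCounit k 𝔤 c ⟨1, he⟩ = 1)
    {δ : k} (hδ : δ = (c + 1) / Module.finrank k 𝔤)
    (hsym : ∀ x y z w, algCounit k 𝔤 c x = 0 → algCounit k 𝔤 c y = 0 → algCounit k 𝔤 c z = 0 →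
      algCounit k 𝔤 c w = 0 → symmetrize (powerDefect
        (reducedMul (algMul k 𝔤 c) ⟨1, he⟩ (algCounit k 𝔤 c))
        ((algMul k 𝔤 c).compr₂ (algCounit k 𝔤 c)) c₀) x y z w = 0) :
    (4 * ((2⁻¹ - δ) ^ 2 + c₀ * (δ - δ ^ 2)) * -c) • SAₗ c h₁ e₂ +
      (4 * (-2 * (2⁻¹ - δ) * δ - δ ^ 2 + c₀ * (δ - δ ^ 2)) * (c / 2)) • SAₗ c e₂ h₂ = 0 := by
  set m := algMul k 𝔤 c with hm
  set ε := algCounit k 𝔤 c with hε'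
  set e : algA k 𝔤 c := ⟨1, he⟩ with he'
  have hcomm := algMul_comm (k := k) (𝔤 := 𝔤) c
  have hunit' : ∀ a, m a e = a := fun a => by rw [hm, hcomm]; exact hunit a
  have h4 : (4 : k) ≠ 0 := by
    rw [show (4 : k) = 2 * 2 by norm_num]; exact mul_ne_zero h2 h2
  have K11 : killingForm k 𝔤 h₁ h₁ = 4 * c := by rw [killingForm_h_h C.t₁, he₁]; ring
  have Kh₁e₁ := killingForm_h_e h2 C.t₁
  have Kh₁f₁ := killingForm_h_f h2 C.t₁
  have Kh₂e₂ := killingForm_h_e h2 C.t₂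
  have Kh₁e₂ : killingForm k 𝔤 h₁ e₂ = 0 := killingForm_h_eq_zero C.t₁ C.f₁_e₂
  have Kh₁h₂ : killingForm k 𝔤 h₁ h₂ = 0 := killingForm_h_eq_zero C.t₁ C.f₁_h₂
  have Ke₁e₂ : killingForm k 𝔤 e₁ e₂ = 0 := killingForm_e_eq_zero h2 C.t₁ C.h₁_e₂
  have Ke₁h₂ : killingForm k 𝔤 e₁ h₂ = 0 := killingForm_e_eq_zero h2 C.t₁ C.h₁_h₂
  have Kf₁e₂ : killingForm k 𝔤 f₁ e₂ = 0 := killingForm_f_eq_zero h2 C.t₁ C.h₁_e₂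
  have Kf₁h₂ : killingForm k 𝔤 f₁ h₂ = 0 := killingForm_f_eq_zero h2 C.t₁ C.h₁_h₂
  set w := omegaH c h₁ with hw
  set a := SAₗ c e₁ e₂ with ha
  set b := SAₗ c f₁ h₂ with hb
  set n := SAₗ c h₁ e₂ with hn
  set u := SAₗ c e₂ h₂ with hu
  have εS (X Y : 𝔤) (h : killingForm k 𝔤 X Y = 0) : ε (SAₗ c X Y) = 0 := by
    rw [hε', algCounit_S c h2, h, mul_zero]
  have εw : ε w = δ := by
    rw [hw, omegaH, map_smul, hε', algCounit_S c h2, K11, hδ, smul_eq_mul]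
    field_simp
  have εa : ε a = 0 := εS _ _ Ke₁e₂
  have εb : ε b = 0 := εS _ _ Kf₁h₂
  have εn : ε n = 0 := εS _ _ Kh₁e₂
  have εu : ε u = 0 := εS _ _ (by rw [killingForm_comm, Kh₂e₂])
  have ww : m w w = w := algMul_omegaH_self h2 hc K11
  have wa : m w a = (2⁻¹ : k) • a := by
    refine algMul_omegaH_eigen h2 hc ?_ C.h₁_e₂ C.e₁_e₂ Kh₁e₁ Kh₁e₂
    rw [lie_h_e' (k := k) C.t₁, lie_smul, lie_h_e' (k := k) C.t₁, smul_smul]; norm_num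
  have wb : m w b = (2⁻¹ : k) • b := by
    refine algMul_omegaH_eigen h2 hc ?_ C.h₁_h₂ C.f₁_h₂ Kh₁f₁ Kh₁h₂
    rw [lie_h_f' (k := k) C.t₁, lie_neg, lie_smul, lie_h_f' (k := k) C.t₁, smul_neg, neg_neg,
      smul_smul]
    norm_num
  have wn : m w n = (2⁻¹ : k) • n := algMul_omegaH_SAₗ h2 hc C.h₁_e₂ Kh₁e₂ K11
  have wu : m w u = 0 := algMul_omegaH_of_comm h2 c C.h₁_e₂ C.h₁_h₂ Kh₁e₂ Kh₁h₂
  have ab : m a b = (c / 2) • u - c • n := algMul_SAₗ_SAₗ h2 C he₁ Kf₁e₂ Ke₁h₂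
  set z := w - δ • e with hz
  have εz : ε z = 0 := by rw [hz, map_sub, map_smul, εw, hε]; simp
  have mz (x : algA k 𝔤 c) : m z x = m w x - δ • x := by
    rw [hz, map_sub, map_smul, LinearMap.sub_apply, LinearMap.smul_apply, hunit]
  have zz : m z z = (1 - 2 * δ) • w + (δ ^ 2) • e := by
    rw [mz, hz, map_sub, map_smul, ww, hunit']
    module
  have fzz : ε (m z z) = δ - δ ^ 2 := by
    rw [zz, map_add, map_smul, map_smul, εw, hε, smul_eq_mul, smul_eq_mul]; ring
  have za : m z a = (2⁻¹ - δ) • a := by rw [mz, wa]; module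
  have zb : m z b = (2⁻¹ - δ) • b := by rw [mz, wb]; module
  have zn : m z n = (2⁻¹ - δ) • n := by rw [mz, wn]; module
  have zu : m z u = -(δ • u) := by rw [mz, wu, zero_sub]
  have εab : ε (m a b) = 0 := by rw [ab, map_sub, map_smul, map_smul, εu, εn]; simp
  have key := symmetrize_powerDefect_of_table (reducedMul m e ε) (m.compr₂ ε) (c₀ := c₀)
    (σ := 2⁻¹ - δ) (δ := δ) (φ := δ - δ ^ 2) (p := c / 2) (q := -c) (z := z) (a := a) (b := b)
    (n := n) (u := u)
    (fun x y => by rw [reducedMul_apply, reducedMul_apply, hm, hcomm])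
    (fun x y => by rw [LinearMap.compr₂_apply, LinearMap.compr₂_apply, hm, hcomm])
    (by rw [reducedMul_apply, fzz, zz, hz, mul_sub, mul_inv_cancel₀ h2]; module)
    (by rw [reducedMul_apply, za, map_smul, εa]; simp)
    (by rw [reducedMul_apply, zb, map_smul, εb]; simp)
    (by rw [reducedMul_apply, εab, ab]; module)
    (by rw [reducedMul_apply, zn, map_smul, εn]; simp)
    (by rw [reducedMul_apply, zu, map_neg, map_smul, εu]; simp)
    (by rw [LinearMap.compr₂_apply, fzz])
    (by rw [LinearMap.compr₂_apply, za, map_smul, εa, smul_zero])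
    (by rw [LinearMap.compr₂_apply, zb, map_smul, εb, smul_zero])
    (by rw [LinearMap.compr₂_apply, εab])
    (by rw [LinearMap.compr₂_apply, zn, map_smul, εn, smul_zero])
    (by rw [LinearMap.compr₂_apply, zu, map_neg, map_smul, εu, smul_zero, neg_zero])
  rw [← key]
  exact hsym z z a b εz εz εa εb

/-- The fourth power identity for the difference of two orthogonal idempotents. -/
theorem two_mul_smul_omega_eq_zero (h2 : (2 : k) ≠ 0) (h3 : (3 : k) ≠ 0) (hc : c ≠ 0)
    (C : CommutingSl2 h₁ e₁ f₁ h₂ e₂ f₂)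
    (K11 : killingForm k 𝔤 h₁ h₁ = 4 * c) (K22 : killingForm k 𝔤 h₂ h₂ = 4 * c)
    (he : (1 : Module.End k 𝔤) ∈ algA k 𝔤 c)
    (hunit : ∀ a, algMul k 𝔤 c ⟨1, he⟩ a = a) (hε : algCounit k 𝔤 c ⟨1, he⟩ = 1)
    {δ : k} (hδ : δ = (c + 1) / Module.finrank k 𝔤)
    (hsym : ∀ x y z w, algCounit k 𝔤 c x = 0 → algCounit k 𝔤 c y = 0 → algCounit k 𝔤 c z = 0 →
      algCounit k 𝔤 c w = 0 → symmetrize (powerDefect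
        (reducedMul (algMul k 𝔤 c) ⟨1, he⟩ (algCounit k 𝔤 c))
        ((algMul k 𝔤 c).compr₂ (algCounit k 𝔤 c)) c₀) x y z w = 0) :
    (2 * δ * (c₀ - 1)) • (omegaH c h₁ + omegaH c h₂ - (2 * δ) • (⟨1, he⟩ : algA k 𝔤 c)) = 0 := by
  set m := algMul k 𝔤 c with hm
  set ε := algCounit k 𝔤 c with hε'
  set e : algA k 𝔤 c := ⟨1, he⟩ with he'
  have hcomm := algMul_comm (k := k) (𝔤 := 𝔤) c
  have hunit' : ∀ a, m a e = a := fun a => by rw [hm, hcomm]; exact hunit a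
  have h4 : (4 : k) ≠ 0 := by
    rw [show (4 : k) = 2 * 2 by norm_num]; exact mul_ne_zero h2 h2
  have h24 : (24 : k) ≠ 0 := by
    rw [show (24 : k) = 2 * 2 * 2 * 3 by norm_num]
    exact mul_ne_zero (mul_ne_zero (mul_ne_zero h2 h2) h2) h3
  have Kh₁h₂ : killingForm k 𝔤 h₁ h₂ = 0 := killingForm_h_eq_zero C.t₁ C.f₁_h₂
  have εw (h : 𝔤) (hh : killingForm k 𝔤 h h = 4 * c) : ε (omegaH c h) = δ := by
    rw [omegaH, map_smul, hε', algCounit_S c h2, hh, hδ, smul_eq_mul]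
    field_simp
  have ε1 := εw h₁ K11
  have ε2 := εw h₂ K22
  have w11 : m (omegaH c h₁) (omegaH c h₁) = omegaH c h₁ := algMul_omegaH_self h2 hc K11
  have w22 : m (omegaH c h₂) (omegaH c h₂) = omegaH c h₂ := algMul_omegaH_self h2 hc K22
  have w12 : m (omegaH c h₁) (omegaH c h₂) = 0 := by
    conv_lhs => rw [omegaH.eq_def c h₂, map_smul]
    rw [hm, algMul_omegaH_of_comm h2 c C.h₁_h₂ C.h₁_h₂ Kh₁h₂ Kh₁h₂, smul_zero]
  have w21 : m (omegaH c h₂) (omegaH c h₁) = 0 := by rw [hm, hcomm]; exact w12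
  set v := omegaH c h₁
  set w := omegaH c h₂
  set ω := v + w - (2 * δ) • e with hω
  have m1 : m (v - w) (v - w) = v + w := by
    simp only [map_sub, LinearMap.sub_apply, w11, w22, w12, w21]; abel
  have r1 : reducedMul m e ε (v - w) (v - w) = ω := by
    rw [reducedMul_apply, m1, map_add, ε1, ε2, hω, two_mul]
  have m2 : m ω (v - w) = (1 - 2 * δ) • (v - w) := by
    simp only [hω, map_sub, map_add, map_smul, LinearMap.sub_apply, LinearMap.add_apply,
      LinearMap.smul_apply, hunit, w11, w22, w12, w21]
    module
  have εvw : ε (v - w) = 0 := by rw [map_sub, ε1, ε2, sub_self]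
  have r2 : reducedMul m e ε ω (v - w) = (1 - 2 * δ) • (v - w) := by
    rw [reducedMul_apply, m2, map_smul, εvw]; simp
  have m3 : m ω ω = (1 - 4 * δ) • (v + w) + (4 * δ ^ 2) • e := by
    simp only [hω, map_sub, map_add, map_smul, LinearMap.sub_apply, LinearMap.add_apply,
      LinearMap.smul_apply, hunit, hunit', w11, w22, w12, w21]
    module
  have r3 : reducedMul m e ε ω ω = (1 - 4 * δ) • ω := by
    rw [reducedMul_apply, m3]
    simp only [map_add, map_smul, ε1, ε2, hε, hω, smul_eq_mul]
    module
  have key : powerDefect (reducedMul m e ε) (m.compr₂ ε) c₀ (v - w) (v - w) (v - w) (v - w) =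
      (2 * δ * (c₀ - 1)) • ω := by
    simp only [powerDefect, r1, r2, r3, LinearMap.compr₂_apply, m1, m2, map_smul, map_add,
      LinearMap.smul_apply, εvw, ε1, ε2, smul_eq_mul, mul_zero, zero_smul]
    module
  have := hsym (v - w) (v - w) (v - w) (v - w) εvw εvw εvw εvw
  -- With four equal arguments all `24` permutations agree; `2` and `3` being invertible, the defect
  -- itself vanishes.
  have h24' : (24 : k) • powerDefect (reducedMul m e ε) (m.compr₂ ε) c₀ (v - w) (v - w) (v - w)
      (v - w) = 0 := by
    rw [← this, symmetrize]
    module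
  rw [← key]
  exact (smul_eq_zero.mp h24').resolve_left h24

/-- The fourth power identity fails on the kernel of the counit. -/
theorem not_forall_symmetrize_eq_zero (h2 : (2 : k) ≠ 0) (h3 : (3 : k) ≠ 0) (hc : c ≠ 0)
    (hc1 : c + 1 ≠ 0) (hdim : (Module.finrank k 𝔤 : k) ≠ 0)
    (C : CommutingSl2 h₁ e₁ f₁ h₂ e₂ f₂) (hS : S k c e₁ e₁ = 0)
    {y : 𝔤} (hy : y ≠ 0) (hy₁ : ⁅h₁, y⁆ = y) {r : k} (hy₂ : ⁅h₂, y⁆ = r • y) (hr : r ^ 2 ≠ 3)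
    (he : (1 : Module.End k 𝔤) ∈ algA k 𝔤 c)
    (hunit : ∀ a, algMul k 𝔤 c ⟨1, he⟩ a = a) (hε : algCounit k 𝔤 c ⟨1, he⟩ = 1) :
    ¬ ∀ x y z w, algCounit k 𝔤 c x = 0 → algCounit k 𝔤 c y = 0 → algCounit k 𝔤 c z = 0 →
      algCounit k 𝔤 c w = 0 → symmetrize (powerDefect
        (reducedMul (algMul k 𝔤 c) ⟨1, he⟩ (algCounit k 𝔤 c))
        ((algMul k 𝔤 c).compr₂ (algCounit k 𝔤 c)) c₀) x y z w = 0 := by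
  intro hsym
  have h4 : (4 : k) ≠ 0 := by
    rw [show (4 : k) = 2 * 2 by norm_num]; exact mul_ne_zero h2 h2
  obtain ⟨δ, hδ⟩ : ∃ δ : k, δ = (c + 1) / Module.finrank k 𝔤 := ⟨_, rfl⟩
  have hδ0 : δ ≠ 0 := by rw [hδ]; exact div_ne_zero hc1 hdim
  have he₁0 := C.t₁.e_ne_zero
  have he₂0 := C.t₂.e_ne_zero
  have he₁ := killingForm_e_f_eq h2 C.t₁ he₁0 hS
  have K11 : killingForm k 𝔤 h₁ h₁ = 4 * c := by rw [killingForm_h_h C.t₁, he₁]; ring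
  have Kh₁e₂ : killingForm k 𝔤 h₁ e₂ = 0 := killingForm_h_eq_zero C.t₁ C.f₁_e₂
  have Kh₁h₂ : killingForm k 𝔤 h₁ h₂ = 0 := killingForm_h_eq_zero C.t₁ C.f₁_h₂
  have Kh₂e₂ := killingForm_h_e h2 C.t₂
  have e₂h₁ : ⁅e₂, h₁⁆ = 0 := by rw [← lie_skew, C.h₁_e₂, neg_zero]
  have h₂h₁ : ⁅h₂, h₁⁆ = 0 := by rw [← lie_skew, C.h₁_h₂, neg_zero]
  have main := congrArg Subtype.val (smul_add_smul_eq_zero h2 hc C he₁ he hunit hε hδ hsym)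
  simp only [Submodule.coe_add, Submodule.coe_smul, coe_SAₗ, ZeroMemClass.coe_zero] at main
  have nh : S k c h₁ e₂ h₁ = (2 * c) • e₂ := by
    rw [S_apply, e₂h₁, lie_self, killingForm_comm, Kh₁e₂, K11]
    simp only [lie_zero, zero_smul, add_zero, smul_zero, zero_add, smul_smul]
    congr 1
    rw [show (4 : k) = 2 * 2 by norm_num]
    field_simp
  have uh : S k c e₂ h₂ h₁ = 0 := by
    rw [S_apply, e₂h₁, h₂h₁, killingForm_comm, Kh₁h₂, killingForm_comm, Kh₁e₂]
    simp
  -- Evaluation at `h₁` isolates the coefficient of `S(h₁ e₂)`, since `S(e₂ h₂)` kills `h₁`.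
  have eqn : (2⁻¹ - δ) ^ 2 + c₀ * (δ - δ ^ 2) = 0 := by
    have h := LinearMap.congr_fun main h₁
    rw [LinearMap.add_apply, LinearMap.smul_apply, LinearMap.smul_apply, nh, uh, smul_zero, add_zero,
      smul_smul, LinearMap.zero_apply] at h
    have h' := (smul_eq_zero.mp h).resolve_right he₂0
    simpa [h2, h4, hc] using h'
  -- Because `(1/2 - δ)² = 1/4 - (δ - δ²)`, the relation `eqn` reads `1/4 + (c₀ - 1)(δ - δ²) = 0`.
  have quarter (hq : (c₀ - 1) * (δ - δ ^ 2) = 0) : False := by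
    have : (4 : k)⁻¹ = 0 := by
      have h5 : (2⁻¹ : k) * 2 = 1 := inv_mul_cancel₀ h2
      have h6 : (4 : k)⁻¹ = 2⁻¹ * 2⁻¹ := by rw [← mul_inv]; norm_num
      rw [h6]
      linear_combination eqn - hq + δ * h5
    exact inv_ne_zero h4 this
  by_cases hu : S k c e₂ h₂ = 0
  -- Evaluating `S(e₂ h₂) = 0` at `h₂` gives the second triple the same normalization as the first,
  -- hence a second idempotent.
  · have K2 : killingForm k 𝔤 e₂ f₂ = 2 * c := by
      have h := LinearMap.congr_fun hu h₂
      rw [S_apply, lie_self, lie_e_h' (k := k) C.t₂, lie_neg, lie_smul, lie_h_e' (k := k) C.t₂,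
        killingForm_comm e₂ h₂, Kh₂e₂, killingForm_h_h C.t₂, LinearMap.zero_apply] at h
      have h' : (killingForm k 𝔤 e₂ f₂ - 2 * c) • e₂ = 0 := by
        rw [← h, lie_zero]
        simp only [zero_smul, add_zero, zero_add]
        match_scalars
        field_simp
        ring
      exact sub_eq_zero.mp ((smul_eq_zero.mp h').resolve_right he₂0)
    have K22 : killingForm k 𝔤 h₂ h₂ = 4 * c := by rw [killingForm_h_h C.t₂, K2]; ring
    have hω := two_mul_smul_omega_eq_zero h2 h3 hc C K11 K22 he hunit hε hδ hsym
    rcases smul_eq_zero.mp hω with h | h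
    · refine quarter ?_
      have : c₀ - 1 = 0 := by simpa [h2, hδ0] using h
      rw [this, zero_mul]
    · have h' := congrArg Subtype.val h
      have Ky₁ : killingForm k 𝔤 h₁ y = 0 := by
        have := killingForm_lie_left (k := k) h₁ h₁ y
        rw [lie_self, hy₁] at this
        simpa using this.symm
      have Ky₂ : killingForm k 𝔤 h₂ y = 0 := by
        have := killingForm_lie_left (k := k) h₂ h₁ y
        rw [h₂h₁, hy₁] at this
        simpa using this.symm
      simp only [omegaH, Submodule.coe_sub, Submodule.coe_add, Submodule.coe_smul, coe_SAₗ,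
        ZeroMemClass.coe_zero] at h'
      -- Both vectors are eigenvectors of the sum of the idempotents, with eigenvalue `1` at `h₁`
      -- and `(1 + r²)/4` at `y`. A scalar operator forces `r² = 3`.
      have a1 := LinearMap.congr_fun h' h₁
      have a2 := LinearMap.congr_fun h' y
      simp only [LinearMap.sub_apply, LinearMap.add_apply, LinearMap.smul_apply, S_apply,
        lie_self, lie_zero, h₂h₁, K11, killingForm_comm h₂ h₁, Kh₁h₂, Ky₁, Ky₂, hy₁, hy₂, lie_smul,
        Module.End.one_apply, LinearMap.zero_apply, zero_smul, smul_zero, add_zero, zero_add] at a1 a2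
      have b1 : (1 - 2 * δ) • h₁ = 0 := by
        rw [← a1]
        match_scalars
        field_simp
        ring
      have b2 : ((1 + r ^ 2) / 4 - 2 * δ) • y = 0 := by
        rw [← a2]
        match_scalars
        rw [show (4 : k) = 2 * 2 by norm_num]
        field_simp
        ring
      have d1 := (smul_eq_zero.mp b1).resolve_right C.t₁.h_ne_zero
      have d2 := (smul_eq_zero.mp b2).resolve_right hy
      refine hr ?_
      have d3 : (1 + r ^ 2) / 4 = 1 := by linear_combination d2 - d1
      rw [div_eq_one_iff_eq h4] at d3
      linear_combination d3
  · rw [eqn, mul_zero, zero_mul, zero_smul, zero_add] at main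
    have h' := (smul_eq_zero.mp main).resolve_right hu
    refine quarter ?_
    have h5 : (2⁻¹ : k) * 2 = 1 := inv_mul_cancel₀ h2
    have h'' : -2 * (2⁻¹ - δ) * δ - δ ^ 2 + c₀ * (δ - δ ^ 2) = 0 := by
      simpa [h2, h4, hc] using h'
    linear_combination h'' + δ * h5

end Contradiction

/-! ### The Killing form and highest root vector in a Chevalley basis. -/

section Eigenvectors

variable {K L : Type*} [Field K] [LieRing L] [LieAlgebra K L]

theorem killingForm_eq_zero_of_eigen {H X Y : L} {a b : K} (hX : ⁅H, X⁆ = a • X)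
    (hY : ⁅H, Y⁆ = b • Y) (hab : a + b ≠ 0) : killingForm K L X Y = 0 := by
  have h := killingForm_lie_left (k := K) X H Y
  rw [← lie_skew, hX, hY, map_neg, map_smul, map_smul, LinearMap.neg_apply,
    LinearMap.smul_apply, smul_eq_mul, smul_eq_mul] at h
  have h' : (a + b) * killingForm K L X Y = 0 := by linear_combination -h
  exact (mul_eq_zero.mp h').resolve_left hab

end Eigenvectors

namespace ChevalleyBasis

variable {ι M N : Type*} [Fintype ι] [AddCommGroup M] [Module ℚ M] [AddCommGroup N] [Module ℚ N]
  {P : RootPairing ι ℚ M N} [P.IsRootSystem] [P.IsCrystallographic] [P.IsReduced]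
  {b : P.Base} {θ : ι} {K L : Type*} [Field K] [LieRing L] [LieAlgebra K L]
  (B : ChevalleyBasis b K L)

/-- The element `[x α, x (-α)]` of the Cartan subalgebra. -/
def co (α : ι) : L := ∑ i, corootCoeff b α i • B.h i

theorem lie_x_x_of_neg {α β : ι} (h : P.root β = -P.root α) : ⁅B.x α, B.x β⁆ = B.co α :=
  B.lie_x_neg α β h _ (coroot_eq_sum b α)

theorem lie_co_x (α β : ι) : ⁅B.co α, B.x β⁆ = (P.pairingIn ℤ β α : K) • B.x β := by
  rw [co, sum_lie]
  simp only [smul_lie, B.lie_h_x, smul_smul]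
  rw [← Finset.sum_smul, ← pairingIn_eq_sum_right, Int.cast_smul_eq_zsmul]

theorem lie_h_co (i : b.support) (α : ι) : ⁅B.h i, B.co α⁆ = 0 := by
  simp [co, lie_sum, B.lie_h_h]

theorem lie_co_co (α β : ι) : ⁅B.co α, B.co β⁆ = 0 := by
  rw [co, sum_lie]
  simp only [smul_lie, B.lie_h_co, smul_zero, Finset.sum_const_zero]

theorem x_ne_zero (α : ι) : B.x α ≠ 0 := by
  rw [← B.basis_inr]
  exact B.basis.ne_zero _

theorem isSl2Triple (h2 : (2 : K) ≠ 0) {α β : ι} (h : P.root β = -P.root α) :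
    IsSl2Triple (B.co α) (B.x α) (B.x β) where
  h_ne_zero h0 := by
    have := B.lie_co_x α α
    rw [h0, zero_lie, P.pairingIn_same, Int.cast_ofNat, eq_comm, smul_eq_zero] at this
    exact this.elim h2 (B.x_ne_zero α)
  lie_e_f := B.lie_x_x_of_neg h
  lie_h_e_nsmul := by rw [lie_co_x, P.pairingIn_same, Int.cast_ofNat, ofNat_smul_eq_nsmul]
  lie_h_f_nsmul := by
    have hβ : β = P.reflectionPerm α α := P.root.injective (by simp [h])
    have : P.pairingIn ℤ β α = -2 := by
      rw [hβ]; simp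
    rw [lie_co_x, this, Int.cast_neg, Int.cast_ofNat, neg_smul, ofNat_smul_eq_nsmul]

/-- The Killing form on elements that act diagonally on the Chevalley basis. -/
theorem killingForm_of_diag {X Y : L} {χ ψ : ι → K} (hX : ∀ α, ⁅X, B.x α⁆ = χ α • B.x α) (hY : ∀ i, ⁅Y, B.h i⁆ = 0)
    (hY' : ∀ α, ⁅Y, B.x α⁆ = ψ α • B.x α) : killingForm K L X Y = ∑ α, χ α * ψ α := by
  classical
  rw [killingForm_apply_apply, LinearMap.trace_eq_matrix_trace K B.basis, Matrix.trace,
    Fintype.sum_sum_type]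
  have h1 (i : b.support) : LinearMap.toMatrix B.basis B.basis
      (LieAlgebra.ad K L X ∘ₗ LieAlgebra.ad K L Y) (Sum.inl i) (Sum.inl i) = 0 := by
    simp [LinearMap.toMatrix_apply, B.basis_inl, hY]
  have h2 (α : ι) : LinearMap.toMatrix B.basis B.basis
      (LieAlgebra.ad K L X ∘ₗ LieAlgebra.ad K L Y) (Sum.inr α) (Sum.inr α) = χ α * ψ α := by
    rw [LinearMap.toMatrix_apply, B.basis_inr, LinearMap.comp_apply, LieAlgebra.ad_apply,
      LieAlgebra.ad_apply, hY', lie_smul, hX, ← B.basis_inr]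
    simp [mul_comm]
  simp only [Matrix.diag_apply, h1, h2, Finset.sum_const_zero, zero_add]

theorem killingForm_co_co (α β : ι) :
    killingForm K L (B.co α) (B.co β) = ∑ γ, (P.pairingIn ℤ γ α : K) * P.pairingIn ℤ γ β := by
  have h (i : b.support) : ⁅B.co β, B.h i⁆ = 0 := by rw [← lie_skew, B.lie_h_co, neg_zero]
  exact B.killingForm_of_diag (B.lie_co_x α) h (B.lie_co_x β)

/-- Combines `K(h, h) = 2 K(e, f)` with the trace computation of `K(h, h)` over the root vectors. -/
theorem two_mul_killingForm_x_x (h2 : (2 : K) ≠ 0) {α β : ι} (h : P.root β = -P.root α) :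
    2 * killingForm K L (B.x α) (B.x β) = sumSq P α := by
  rw [← killingForm_h_h (B.isSl2Triple h2 h), killingForm_co_co, sumSq]
  push_cast
  simp only [pow_two]

theorem killingForm_x_eq_zero (h2 : (2 : K) ≠ 0) {α : ι} {Y : L} (hY : ⁅B.co α, Y⁆ = 0) :
    killingForm K L (B.x α) Y = 0 := by
  refine killingForm_eq_zero_of_eigen (B.lie_co_x α α) (hY.trans (zero_smul K Y).symm) ?_
  simpa using h2

/-- It is enough that `α + β` be nonzero in `K` on some coroot. For `α ≠ ±β`, one of the two Cartan
integers is `0` or `±1`, and adding `2` gives `1`, `2` or `3`. -/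
theorem killingForm_x_x_eq_zero (h2 : (2 : K) ≠ 0) (h3 : (3 : K) ≠ 0) {α β : ι}
    (h : P.root α + P.root β ≠ 0) : killingForm K L (B.x α) (B.x β) = 0 := by
  have key (γ : ι) (hγ : (P.pairingIn ℤ α γ : K) + P.pairingIn ℤ β γ ≠ 0) :
      killingForm K L (B.x α) (B.x β) = 0 :=
    killingForm_eq_zero_of_eigen (B.lie_co_x γ α) (B.lie_co_x γ β) hγ
  by_cases hαβ : α = β
  · subst hαβ
    refine key α ?_
    rw [P.pairingIn_same, Int.cast_ofNat, ← two_mul]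
    exact mul_ne_zero h2 h2
  have h' := P.pairingIn_pairingIn_mem_set_of_isCrystal_of_isRed' α β
    (fun h' => hαβ (P.root.injective h')) (fun h' => h (by rw [h', neg_add_cancel]))
  have : (P.pairingIn ℤ β α = 0 ∨ P.pairingIn ℤ β α = 1 ∨ P.pairingIn ℤ β α = -1) ∨
      (P.pairingIn ℤ α β = 0 ∨ P.pairingIn ℤ α β = 1 ∨ P.pairingIn ℤ α β = -1) := by
    simp only [Set.mem_insert_iff, Set.mem_singleton_iff, Prod.mk.injEq] at h'
    lia
  rcases this with h4 | h4
  · refine key α ?_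
    rw [P.pairingIn_same]
    rcases h4 with h4 | h4 | h4 <;> rw [h4] <;> norm_num [h2, h3]
  · refine key β ?_
    rw [P.pairingIn_same]
    rcases h4 with h4 | h4 | h4 <;> rw [h4] <;> norm_num [h2, h3]

theorem cast_pairingIn_ne_zero (h2 : (2 : K) ≠ 0) (h3 : (3 : K) ≠ 0) {α β : ι}
    (h : P.pairingIn ℤ α β ≠ 0) : (P.pairingIn ℤ α β : K) ≠ 0 := by
  have h' := P.pairingIn_pairingIn_mem_set_of_isCrystal_of_isRed α β
  have : P.pairingIn ℤ α β = 1 ∨ P.pairingIn ℤ α β = -1 ∨ P.pairingIn ℤ α β = 2 ∨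
      P.pairingIn ℤ α β = -2 ∨ P.pairingIn ℤ α β = 3 ∨ P.pairingIn ℤ α β = -3 := by
    simp only [Set.mem_insert_iff, Set.mem_singleton_iff, Prod.mk.injEq] at h'
    lia
  rcases this with h4 | h4 | h4 | h4 | h4 | h4 <;> rw [h4] <;> simp [h2, h3]

theorem cast_sumSq_ne_zero [P.IsIrreducible] (h2 : (2 : K) ≠ 0) (h3 : (3 : K) ≠ 0)
    (hθ : IsHighestRoot b θ) (hD : (dualCoxeterNumber b θ : K) ≠ 0) (α : ι) :
    (sumSq P α : K) ≠ 0 := by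
  obtain ⟨β, h4, h5⟩ := exists_sumSq_eq_and_pairingIn_ne_zero (P := P) α θ
  have h6 := congrArg (Int.cast (R := K)) (sumSq_mul_pairingIn (P := P) α β)
  rw [Int.cast_mul, Int.cast_mul, h4, sumSq, sumSq, sum_pairingIn_sq hθ, Int.cast_mul] at h6
  intro h7
  rw [sumSq] at h7
  rw [h7, zero_mul] at h6
  refine mul_ne_zero (mul_ne_zero ?_ hD) (cast_pairingIn_ne_zero h2 h3 h5) h6.symm
  rw [show (4 : ℤ) = 2 * 2 by norm_num, Int.cast_mul, Int.cast_ofNat]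
  exact mul_ne_zero h2 h2

theorem finrank_eq (B : ChevalleyBasis b K L) [P.IsIrreducible] :
    Module.finrank K L = Fintype.card b.support * (coxeterNumber P + 1) := by
  classical
  rw [Module.finrank_eq_card_basis B.basis, Fintype.card_sum, (card_eq_and_sum_pos b).1]
  ring

/-- Pairing with opposite root vectors removes the root components of `X`. For the remaining Cartan
part, `K(X, [x_α, x_{-α}]) = α(X) K(x_α, x_{-α})` gives `α(X) = 0` for every root, and then `∑_{α >
0} α(X) α^∨ = h X` gives `X = 0`. -/
theorem killingForm_separating (B : ChevalleyBasis b K L) [P.IsIrreducible] (h2 : (2 : K) ≠ 0) (h3 : (3 : K) ≠ 0)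
    (hθ : IsHighestRoot b θ) (hD : (dualCoxeterNumber b θ : K) ≠ 0)
    (hh : (coxeterNumber P : K) ≠ 0) {X : L} (hX : ∀ Y, killingForm K L X Y = 0) : X = 0 := by
  classical
  have hneg (α : ι) : P.root (P.reflectionPerm α α) = -P.root α := by simp
  have hK (α : ι) : killingForm K L (B.x α) (B.x (P.reflectionPerm α α)) ≠ 0 := by
    intro h
    have h4 := B.two_mul_killingForm_x_x h2 (hneg α)
    rw [h, mul_zero] at h4
    exact cast_sumSq_ne_zero h2 h3 hθ hD α h4.symm
  obtain ⟨d, hd⟩ : ∃ d, d = fun α => B.basis.repr X (Sum.inr α) := ⟨_, rfl⟩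
  obtain ⟨c, hc⟩ : ∃ c, c = fun i => B.basis.repr X (Sum.inl i) := ⟨_, rfl⟩
  have hsum : X = ∑ i, c i • B.h i + ∑ α, d α • B.x α := by
    conv_lhs => rw [← B.basis.sum_repr X, Fintype.sum_sum_type]
    simp only [B.basis_inl, B.basis_inr, hc, hd]
  have hKh (i : b.support) (α : ι) : killingForm K L (B.h i) (B.x α) = 0 := by
    rw [killingForm, LieModule.traceForm_comm]
    exact B.killingForm_x_eq_zero h2 (by rw [← lie_skew, B.lie_h_co, neg_zero])
  have hd0 (α : ι) : d α = 0 := by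
    have h := hX (B.x (P.reflectionPerm α α))
    rw [hsum, map_add, LinearMap.add_apply, map_sum, map_sum, LinearMap.sum_apply,
      LinearMap.sum_apply, Finset.sum_eq_zero (fun i _ => by simp [hKh]), zero_add,
      Finset.sum_eq_single α, map_smul, LinearMap.smul_apply] at h
    · exact (smul_eq_zero.mp h).resolve_right (hK α)
    · intro β _ hβ
      rw [map_smul, LinearMap.smul_apply, B.killingForm_x_x_eq_zero h2 h3, smul_zero]
      rw [hneg, ← sub_eq_add_neg, sub_ne_zero]
      exact fun h => hβ (P.root.injective h)
    · simp
  have hsum' : X = ∑ i, c i • B.h i := by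
    rw [hsum]; simp [hd0]
  have hχ (α : ι) : ∑ i : b.support, c i * (P.pairingIn ℤ α i : K) = 0 := by
    have h := hX (B.co α)
    have h4 : ⁅X, B.x α⁆ = (∑ i : b.support, c i * (P.pairingIn ℤ α i : K)) • B.x α := by
      rw [hsum', sum_lie, Finset.sum_smul]
      refine Finset.sum_congr rfl fun i _ => ?_
      rw [smul_lie, B.lie_h_x, mul_smul, Int.cast_smul_eq_zsmul]
    rw [← B.lie_x_x_of_neg (hneg α), ← killingForm_lie_left, h4, map_smul, LinearMap.smul_apply] at h
    exact (smul_eq_zero.mp h).resolve_right (hK α)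
  have hc0 (j : b.support) : c j = 0 := by
    have h4 : ∑ α with b.IsPos α, (corootCoeff b α j : K) *
        ∑ i : b.support, c i * (P.pairingIn ℤ α i : K) = c j * coxeterNumber P := by
      simp_rw [Finset.mul_sum]
      rw [Finset.sum_comm]
      calc _ = ∑ i : b.support, c i *
            ((∑ α with b.IsPos α, P.pairingIn ℤ α i * corootCoeff b α j : ℤ) : K) := by
            refine Finset.sum_congr rfl fun i _ => ?_
            rw [Int.cast_sum, Finset.mul_sum]
            refine Finset.sum_congr rfl fun α _ => ?_
            push_cast
            ring
        _ = _ := by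
            simp_rw [(card_eq_and_sum_pos b).2]
            simp
    simp only [hχ, mul_zero, Finset.sum_const_zero] at h4
    exact (mul_eq_zero.mp h4.symm).resolve_right hh
  rw [hsum']
  simp [hc0]

/-- `(ad x_θ)²` kills every basis vector except the one of root `-θ`, because `2θ + β` is never zero
or a root otherwise. On that vector it gives `-2 x_θ`, cancelled by `K(x_θ, x_{-θ}) = 2h^∨`. -/
theorem S_highestRoot (h2 : (2 : K) ≠ 0) (h3 : (3 : K) ≠ 0) (hθ : IsHighestRoot b θ) :
    S K (dualCoxeterNumber b θ : K) (B.x θ) (B.x θ) = 0 := by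
  have hS (Z : L) : S K (dualCoxeterNumber b θ : K) (B.x θ) (B.x θ) Z =
      (dualCoxeterNumber b θ : K) • ⁅B.x θ, ⁅B.x θ, Z⁆⁆ + killingForm K L (B.x θ) Z • B.x θ := by
    rw [S_apply]
    match_scalars <;> field_simp <;> ring
  refine B.basis.ext fun s => ?_
  rw [LinearMap.zero_apply, hS]
  rcases s with i | β
  · rw [B.basis_inl, B.killingForm_x_eq_zero h2 (by rw [← lie_skew, B.lie_h_co, neg_zero]),
      ← lie_skew (B.x θ) (B.h i), B.lie_h_x]
    simp
  · rw [B.basis_inr]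
    by_cases h : P.root θ + P.root β = 0
    · have h' : P.root β = -P.root θ := (neg_eq_of_add_eq_zero_right h).symm
      have h4 := B.two_mul_killingForm_x_x h2 h'
      rw [sumSq, sum_pairingIn_sq hθ] at h4
      have h5 : killingForm K L (B.x θ) (B.x β) = 2 * dualCoxeterNumber b θ := by
        refine mul_left_cancel₀ h2 ?_
        rw [h4]; push_cast; ring
      rw [h5, B.lie_x_x_of_neg h', lie_e_h' (k := K) (B.isSl2Triple h2 h')]
      module
    · rw [B.killingForm_x_x_eq_zero h2 h3 h, zero_smul, add_zero]
      by_cases hr : P.root θ + P.root β ∈ Set.range P.root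
      · obtain ⟨γ, hγ⟩ := hr
        have h4 : ⁅B.x θ, B.x γ⁆ = 0 := by
          refine B.lie_x_x_eq_zero θ γ (fun h5 => ?_) ?_
          · have : IsAddTorsionFree M := .of_module_rat M
            refine P.nsmul_notMem_range_root (n := 2) (i := θ) ⟨P.reflectionPerm β β, ?_⟩
            rw [P.root_reflectionPerm, P.reflection_apply_self, neg_eq_iff_add_eq_zero, two_smul]
            rw [hγ] at h5
            rw [← h5]; abel
          · rintro ⟨δ, hδ⟩
            rw [hγ] at hδ
            exact h (eq_neg_of_two_add_mem hθ hδ)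
        rcases B.lie_x_x θ β γ hγ.symm with h5 | h5 <;> rw [h5] <;> simp [h4]
      · rw [B.lie_x_x_eq_zero θ β h hr, lie_zero, smul_zero]

theorem commutingSl2 (h2 : (2 : K) ≠ 0) (hθ : IsHighestRoot b θ) {j : ι} (hj : b.IsPos j)
    (hjθ : P.pairingIn ℤ θ j = 0) :
    CommutingSl2 (B.co θ) (B.x θ) (B.x (P.reflectionPerm θ θ)) (B.co j) (B.x j)
      (B.x (P.reflectionPerm j j)) := by
  have hjθ' : P.pairingIn ℤ j θ = 0 := P.pairingIn_eq_zero_iff.mp hjθ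
  have hneg (α : ι) : P.root (P.reflectionPerm α α) = -P.root α := by simp
  have hmem (α β : ι) (s : M) (hs : s = P.root α + P.root β) (h : s ∉ Set.range P.root)
      (h0 : s ≠ 0) : ⁅B.x α, B.x β⁆ = 0 := by
    subst hs; exact B.lie_x_x_eq_zero α β h0 h
  have hnr (s : M) (h : s ∉ Set.range P.root) : -s ∉ Set.range P.root := by
    rintro ⟨α, hα⟩
    exact h ⟨P.reflectionPerm α α, by rw [hneg, hα, neg_neg]⟩
  have a1 := add_notMem_range_root hθ hj
  have a2 := sub_notMem_range_root hθ hj hjθ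
  have a3 : P.root θ + P.root j ≠ 0 := by
    intro h
    have : θ = P.reflectionPerm j j := P.root.injective (by
      rw [hneg]; exact eq_neg_of_add_eq_zero_left h)
    rw [this] at hjθ
    simp at hjθ
  have a4 : P.root θ - P.root j ≠ 0 := by
    intro h
    have : θ = j := P.root.injective (sub_eq_zero.mp h)
    rw [this, P.pairingIn_same] at hjθ
    norm_num at hjθ
  have e₁h₂ : ⁅B.x θ, B.co j⁆ = 0 := by rw [← lie_skew, B.lie_co_x, hjθ]; simp
  have f₁h₂ : ⁅B.x (P.reflectionPerm θ θ), B.co j⁆ = 0 := by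
    rw [← lie_skew, B.lie_co_x, P.pairingIn_reflectionPerm_self_left, hjθ]; simp
  exact
  { t₁ := B.isSl2Triple h2 (hneg θ)
    t₂ := B.isSl2Triple h2 (hneg j)
    h₁_h₂ := B.lie_co_co θ j
    h₁_e₂ := by rw [B.lie_co_x, hjθ']; simp
    h₁_f₂ := by rw [B.lie_co_x, P.pairingIn_reflectionPerm_self_left, hjθ']; simp
    e₁_h₂ := e₁h₂
    e₁_e₂ := hmem _ _ _ rfl a1 a3
    e₁_f₂ := hmem _ _ _ (by rw [hneg]; abel) a2 a4
    f₁_h₂ := f₁h₂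
    f₁_e₂ := hmem _ _ _ (by rw [hneg]; abel) (hnr _ a2) (neg_ne_zero.mpr a4)
    f₁_f₂ := hmem _ _ _ (by rw [hneg, hneg]; abel) (hnr _ a1) (neg_ne_zero.mpr a3) }

/-- The squares of Cartan integers are `0`, `1`, `4`, `9`; subtracting `3` leaves `-3`, `-2`, `1`,
`6`, all invertible. -/
theorem cast_pairingIn_sq_ne_three (h2 : (2 : K) ≠ 0) (h3 : (3 : K) ≠ 0) (α β : ι) :
    (P.pairingIn ℤ α β : K) ^ 2 ≠ 3 := by
  have h' := P.pairingIn_pairingIn_mem_set_of_isCrystal_of_isRed α β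
  have : P.pairingIn ℤ α β ^ 2 - 3 = -3 ∨ P.pairingIn ℤ α β ^ 2 - 3 = -2 ∨
      P.pairingIn ℤ α β ^ 2 - 3 = 1 ∨ P.pairingIn ℤ α β ^ 2 - 3 = 2 * 3 := by
    simp only [Set.mem_insert_iff, Set.mem_singleton_iff, Prod.mk.injEq] at h'
    rcases h' with h | h | h | h | h | h | h | h | h | h | h | h | h <;> rw [h.1] <;> norm_num
  rw [← sub_ne_zero]
  have h4 : (P.pairingIn ℤ α β : K) ^ 2 - 3 = ((P.pairingIn ℤ α β ^ 2 - 3 : ℤ) : K) := by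
    push_cast; rfl
  rw [h4]
  rcases this with h | h | h | h <;> rw [h]
  · simp [h3]
  · simp [h2]
  · simp
  · rw [Int.cast_mul, Int.cast_ofNat, Int.cast_ofNat]; exact mul_ne_zero h2 h3

/-- The fourth power identity fails on the kernel of the counit, for a Lie algebra with a Chevalley
basis not of type `A₁` or `A₂`. -/
theorem not_forall_symmetrize_eq_zero (B : ChevalleyBasis b K L) [FiniteDimensional K L] [P.IsIrreducible] (h2 : (2 : K) ≠ 0)
    (h3 : (3 : K) ≠ 0)
    (hθ : IsHighestRoot b θ) (hA₁ : ¬ IsTypeA b 1) (hA₂ : ¬ IsTypeA b 2) {c : K}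
    (hc : c = dualCoxeterNumber b θ) (hc0 : c ≠ 0) (hc1 : c + 1 ≠ 0)
    (hdim : (Module.finrank K L : K) ≠ 0) (he : (1 : Module.End K L) ∈ algA K L c)
    (hunit : ∀ a, algMul K L c ⟨1, he⟩ a = a) (hε : algCounit K L c ⟨1, he⟩ = 1) (c₀ : K) :
    ¬ ∀ x y z w, algCounit K L c x = 0 → algCounit K L c y = 0 → algCounit K L c z = 0 →
      algCounit K L c w = 0 → symmetrize (powerDefect
        (reducedMul (algMul K L c) ⟨1, he⟩ (algCounit K L c))
        ((algMul K L c).compr₂ (algCounit K L c)) c₀) x y z w = 0 := by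
  obtain ⟨j, hj⟩ := exists_simple_orthogonal hθ hA₁ hA₂
  obtain ⟨i, hi⟩ := exists_simple_pairingIn_eq_one hθ hA₁
  have hS := B.S_highestRoot h2 h3 hθ
  rw [← hc] at hS
  refine ChayetGaribaldi.not_forall_symmetrize_eq_zero h2 h3 hc0 hc1 hdim
    (B.commutingSl2 h2 hθ (b.isPos_of_mem_support j.2) hj) hS (B.x_ne_zero i) ?_
    (B.lie_co_x j i) (cast_pairingIn_sq_ne_three h2 h3 _ _) he hunit hε
  rw [B.lie_co_x, hi, Int.cast_one, one_smul]

end ChevalleyBasis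

/-! ### Casimir sums over dual bases. -/

section Casimir

variable {k 𝔤 I : Type*} [Field k] [LieRing 𝔤] [LieAlgebra k 𝔤] [Fintype I] {x x' : I → 𝔤}

/-- Two families of vectors form dual bases with respect to the Killing form. -/
structure KillingDual (k : Type*) {𝔤 I : Type*} [Field k] [LieRing 𝔤] [LieAlgebra k 𝔤] [Fintype I]
    (x x' : I → 𝔤) : Prop where
  left : ∀ Z, ∑ i, killingForm k 𝔤 (x' i) Z • x i = Z
  right : ∀ Z, ∑ i, killingForm k 𝔤 (x i) Z • x' i = Z

theorem KillingDual.symm (h : KillingDual k x x') : KillingDual k x' x := ⟨h.right, h.left⟩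

theorem exists_killingDual [FiniteDimensional k 𝔤]
    (h : ∀ X : 𝔤, (∀ Y, killingForm k 𝔤 X Y = 0) → X = 0) :
    ∃ (n : ℕ) (x x' : Fin n → 𝔤), KillingDual k x x' := by
  have hK : (killingForm k 𝔤).Nondegenerate :=
    ⟨h, fun Y hY => h Y fun X => by rw [killingForm_comm]; exact hY X⟩
  set v := Module.finBasis k 𝔤
  set w := LinearMap.BilinForm.dualBasis (killingForm k 𝔤) hK v
  have hw (i j) : killingForm k 𝔤 (w i) (v j) = if j = i then 1 else 0 :=
    LinearMap.BilinForm.apply_dualBasis_left hK v i j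
  refine ⟨_, v, w, fun Z => ?_, fun Z => ?_⟩
  · conv_rhs => rw [← v.sum_repr Z]
    refine Finset.sum_congr rfl fun i _ => ?_
    congr 1
    have hi := congrArg (killingForm k 𝔤 (w i)) (v.sum_repr Z)
    rw [← hi, map_sum]
    simp only [map_smul, hw, smul_eq_mul, mul_ite, mul_one, mul_zero, Finset.sum_ite_eq',
      Finset.mem_univ, if_true]
  · conv_rhs => rw [← w.sum_repr Z]
    refine Finset.sum_congr rfl fun i _ => ?_
    congr 1
    have hi := congrArg (killingForm k 𝔤 (v i)) (w.sum_repr Z)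
    rw [← hi, map_sum]
    simp only [(killingForm k 𝔤 (v i)).map_smul, killingForm_comm (v i), hw, smul_eq_mul, mul_ite,
      mul_one, mul_zero,
      Finset.sum_ite_eq, Finset.mem_univ, if_true]

/-- The Casimir tensor `∑ x i ⊗ x' i` is invariant. -/
theorem KillingDual.sum_lie_add (h : KillingDual k x x') {E : Type*} [AddCommGroup E] [Module k E]
    (F : 𝔤 →ₗ[k] 𝔤 →ₗ[k] E) (Y : 𝔤) :
    ∑ i, F ⁅Y, x i⁆ (x' i) = -∑ i, F (x i) ⁅Y, x' i⁆ := by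
  have h1 (i : I) : F ⁅Y, x i⁆ (x' i) =
      ∑ j, killingForm k 𝔤 (x' j) ⁅Y, x i⁆ • F (x j) (x' i) := by
    conv_lhs => rw [← h.left ⁅Y, x i⁆]
    simp only [map_sum, map_smul, LinearMap.sum_apply, LinearMap.smul_apply]
  have h2 (j : I) : F (x j) ⁅Y, x' j⁆ =
      ∑ i, killingForm k 𝔤 (x i) ⁅Y, x' j⁆ • F (x j) (x' i) := by
    conv_lhs => rw [← h.right ⁅Y, x' j⁆]
    simp only [map_sum, map_smul]
  simp only [h1, h2]
  rw [Finset.sum_comm, ← Finset.sum_neg_distrib]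
  refine Finset.sum_congr rfl fun j _ => ?_
  rw [← Finset.sum_neg_distrib]
  refine Finset.sum_congr rfl fun i _ => ?_
  rw [← neg_smul, ← killingForm_lie_left, ← lie_skew, map_neg, LinearMap.neg_apply,
    killingForm, LieModule.traceForm_comm]

theorem KillingDual.trace_eq [FiniteDimensional k 𝔤] (h : KillingDual k x x')
    (T : Module.End k 𝔤) : LinearMap.trace k 𝔤 T = ∑ i, killingForm k 𝔤 (x' i) (T (x i)) := by
  have hT : T = ∑ i, (killingForm k 𝔤 (x' i)).smulRight (T (x i)) := by
    ext Z
    conv_lhs => rw [← h.left Z]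
    simp
  conv_lhs => rw [hT]
  simp [LinearMap.trace_smulRight]

/-- The Casimir element acts as the identity on the adjoint representation. -/
theorem KillingDual.casimir [FiniteDimensional k 𝔤] (h : KillingDual k x x') (A : 𝔤) :
    ∑ i, ⁅x i, ⁅x' i, A⁆⁆ = A := by
  have key (B : 𝔤) : killingForm k 𝔤 B (∑ i, ⁅x i, ⁅x' i, A⁆⁆) = killingForm k 𝔤 B A := by
    rw [killingForm_comm B A, map_sum, killingForm_apply_apply, h.trace_eq]
    refine Finset.sum_congr rfl fun i _ => ?_
    rw [LinearMap.comp_apply, LieAlgebra.ad_apply, LieAlgebra.ad_apply,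
      ← killingForm_lie_left B, ← killingForm_lie_left (x' i), killingForm_comm]
  rw [← h.left (∑ i, ⁅x i, ⁅x' i, A⁆⁆)]
  simp only [key]
  exact h.left A

theorem KillingDual.sum_S [FiniteDimensional k 𝔤] (h2 : (2 : k) ≠ 0) (h : KillingDual k x x')
    (c : k) : ∑ i, S k c (x i) (x' i) = (c + 1) • (1 : Module.End k 𝔤) := by
  ext Z
  simp only [LinearMap.sum_apply, S_apply, Finset.sum_add_distrib, ← Finset.smul_sum,
    h.casimir, h.symm.casimir, h.left, h.right, LinearMap.smul_apply, Module.End.one_apply]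
  match_scalars
  field_simp
  ring

/-- Expanding the product yields four groups of terms. Invariance of the Casimir tensor makes the
double brackets on the basis vectors cancel the mixed terms `S([C, xᵢ] [D, x'ᵢ])`. The Killing terms
give `1`, and the Casimir acting on `C` and `D` gives `c`. -/
theorem KillingDual.sum_prodAux_S [FiniteDimensional k 𝔤] (h2 : (2 : k) ≠ 0)
    (h : KillingDual k x x') (c : k) (C D : 𝔤) :
    ∑ i, prodAux k c (x i) (x' i) (S k c C D) = (c + 1) • S k c C D := by
  have h4 : (4 : k) = 2 * 2 := by norm_num
  set F := S k (𝔤 := 𝔤) c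
  have i1 := h.sum_lie_add (F.compl₂ (LieAlgebra.ad k 𝔤 D)) C
  have i2 := h.sum_lie_add (F.compl₂ (LieAlgebra.ad k 𝔤 C)) D
  have i3 := h.sum_lie_add (F ∘ₗ (LieAlgebra.ad k 𝔤 D)) C
  have i4 := h.sum_lie_add (F ∘ₗ (LieAlgebra.ad k 𝔤 C)) D
  simp only [LinearMap.compl₂_apply, LinearMap.comp_apply, LieAlgebra.ad_apply] at i1 i2 i3 i4
  have p1 : ∑ i, killingForm k 𝔤 D (x' i) • F C (x i) = F C D := by
    simp only [killingForm_comm D, ← map_smul, ← map_sum, h.left]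
  have p2 : ∑ i, killingForm k 𝔤 C (x' i) • F D (x i) = F C D := by
    simp only [killingForm_comm C, ← map_smul, ← map_sum, h.left]
    exact S_comm k c D C
  have p3 : ∑ i, killingForm k 𝔤 D (x i) • F C (x' i) = F C D := by
    simp only [killingForm_comm D, ← map_smul, ← map_sum, h.right]
  have p4 : ∑ i, killingForm k 𝔤 C (x i) • F D (x' i) = F C D := by
    simp only [killingForm_comm C, ← map_smul, ← map_sum, h.right]
    exact S_comm k c D C
  have q1 : ∑ i, F ⁅x i, ⁅x' i, C⁆⁆ D = F C D := by
    simp only [← LinearMap.sum_apply, ← map_sum, h.casimir]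
  have q2 : ∑ i, F ⁅x' i, ⁅x i, C⁆⁆ D = F C D := by
    simp only [← LinearMap.sum_apply, ← map_sum, h.symm.casimir]
  have q3 : ∑ i, F C ⁅x i, ⁅x' i, D⁆⁆ = F C D := by
    simp only [← map_sum, h.casimir]
  have q4 : ∑ i, F C ⁅x' i, ⁅x i, D⁆⁆ = F C D := by
    simp only [← map_sum, h.symm.casimir]
  have term (i : I) : prodAux k c (x i) (x' i) (F C D) =
      (c / 4) • (F (x i) ⁅D, ⁅C, x' i⁆⁆ + F (x i) ⁅C, ⁅D, x' i⁆⁆ + F ⁅D, ⁅C, x i⁆⁆ (x' i)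
        + F ⁅C, ⁅D, x i⁆⁆ (x' i))
      + (4⁻¹ : k) • (killingForm k 𝔤 D (x' i) • F C (x i) + killingForm k 𝔤 C (x' i) • F D (x i)
        + killingForm k 𝔤 D (x i) • F C (x' i) + killingForm k 𝔤 C (x i) • F D (x' i))
      + (c / 4) • (F ⁅x i, ⁅x' i, C⁆⁆ D + F ⁅x' i, ⁅x i, C⁆⁆ D + F C ⁅x i, ⁅x' i, D⁆⁆
        + F C ⁅x' i, ⁅x i, D⁆⁆)
      + (c / 2) • (F ⁅C, x i⁆ ⁅D, x' i⁆ + F ⁅D, x i⁆ ⁅C, x' i⁆) := by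
    have e1 : F ⁅x' i, C⁆ ⁅x i, D⁆ = F ⁅D, x i⁆ ⁅C, x' i⁆ := by
      rw [show F ⁅x' i, C⁆ ⁅x i, D⁆ = F ⁅x i, D⁆ ⁅x' i, C⁆ from S_comm k c _ _,
        ← lie_skew (x i) D, ← lie_skew (x' i) C, map_neg, map_neg, LinearMap.neg_apply, neg_neg]
    have e2 : F ⁅x i, C⁆ ⁅x' i, D⁆ = F ⁅C, x i⁆ ⁅D, x' i⁆ := by
      rw [← lie_skew (x i) C, ← lie_skew (x' i) D, map_neg, map_neg, LinearMap.neg_apply, neg_neg]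
    have hF (Z : 𝔤) : F C D Z = _ := S_apply c C D Z
    have hE (X Y Z : 𝔤) : adEnd k X (F Y Z) = F ⁅X, Y⁆ Z + F Y ⁅X, Z⁆ := adEnd_S k c X Y Z
    have hs (Y : 𝔤) : F (x i) Y = F Y (x i) := S_comm k c _ _
    change (2⁻¹ : k) • (F (x i) (F C D (x' i)) + F (F C D (x i)) (x' i))
      + (c / 4) • (adEnd k (x i) (adEnd k (x' i) (F C D))
        + adEnd k (x' i) (adEnd k (x i) (F C D))) = _
    simp only [hF, hE, map_add, map_smul, LinearMap.add_apply, LinearMap.smul_apply, e1, e2, hs C,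
      hs D, h4]
    match_scalars <;> field_simp <;> ring
  simp only [term, Finset.sum_add_distrib, ← Finset.smul_sum, p1, p2, p3, p4, q1, q2, q3, q4, i3,
    i4]
  have i1' : ∑ i, F (x i) ⁅D, ⁅C, x' i⁆⁆ = -∑ i, F ⁅C, x i⁆ ⁅D, x' i⁆ := by rw [i1, neg_neg]
  have i2' : ∑ i, F (x i) ⁅C, ⁅D, x' i⁆⁆ = -∑ i, F ⁅D, x i⁆ ⁅C, x' i⁆ := by rw [i2, neg_neg]
  rw [i1', i2', h4]
  match_scalars <;> field_simp <;> ring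

end Casimir

/-! ### The identity element. -/

section Identity

variable {k 𝔤 : Type*} [Field k] [LieRing 𝔤] [LieAlgebra k 𝔤] [FiniteDimensional k 𝔤]

theorem exists_one_mem_algA (h2 : (2 : k) ≠ 0)
    (h : ∀ X : 𝔤, (∀ Y, killingForm k 𝔤 X Y = 0) → X = 0) {c : k} (hc : c + 1 ≠ 0) :
    ∃ he : (1 : Module.End k 𝔤) ∈ algA k 𝔤 c, ∀ a, algMul k 𝔤 c ⟨1, he⟩ a = a := by
  obtain ⟨n, x, x', hx⟩ := exists_killingDual h
  have h1 : (((c + 1)⁻¹ • ∑ i, SAₗ c (x i) (x' i) : algA k 𝔤 c) : Module.End k 𝔤) = 1 := by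
    rw [Submodule.coe_smul, AddSubmonoidClass.coe_finsetSum]
    simp only [coe_SAₗ]
    rw [hx.sum_S h2, inv_smul_smul₀ hc]
  have he : (1 : Module.End k 𝔤) ∈ algA k 𝔤 c := h1 ▸ Subtype.property _
  refine ⟨he, fun a => ?_⟩
  rw [show (⟨1, he⟩ : algA k 𝔤 c) = (c + 1)⁻¹ • ∑ i, SAₗ c (x i) (x' i) from Subtype.ext h1.symm]
  induction a using algA_induction with
  | hadd a b ha hb => rw [map_add, ha, hb]
  | hS C D =>
    apply Subtype.ext
    rw [map_smul, map_sum, LinearMap.smul_apply, LinearMap.sum_apply, Submodule.coe_smul,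
      AddSubmonoidClass.coe_finsetSum]
    simp only [coe_algMul_S, coe_SAₗ]
    rw [hx.sum_prodAux_S h2, inv_smul_smul₀ hc]

theorem algCounit_one {c : k} (hdim : (Module.finrank k 𝔤 : k) ≠ 0)
    (he : (1 : Module.End k 𝔤) ∈ algA k 𝔤 c) : algCounit k 𝔤 c ⟨1, he⟩ = 1 := by
  simp [algCounit, hdim]

end Identity

/-! ### The bound on the characteristic. -/

section Field

theorem natCast_ne_zero_of_ringChar {K : Type*} [Field K] {m n : ℕ}
    (hK : ringChar K = 0 ∨ m ≤ ringChar K) (hn : n ≠ 0) (hm : n < m) : (n : K) ≠ 0 := by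
  rw [Ne, ringChar.spec]
  intro h
  rcases hK with h' | h'
  · rw [h', zero_dvd_iff] at h
    exact hn h
  · exact absurd (Nat.le_of_dvd (Nat.pos_of_ne_zero hn) h) (by lia)

end Field

/-! ### Extension of scalars to the split form. -/

section BaseChange

variable {k 𝔤 : Type*} [Field k] [LieRing 𝔤] [LieAlgebra k 𝔤] [FiniteDimensional k 𝔤]
  (K : Type*) [Field K] [Algebra k K] (c : k)

theorem killingForm_tmul (r s : K) (X Y : 𝔤) :
    killingForm K (K ⊗[k] 𝔤) (r ⊗ₜ X) (s ⊗ₜ Y) = r * s * algebraMap k K (killingForm k 𝔤 X Y) := by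
  rw [killingForm, LieModule.traceForm_baseChange, LinearMap.BilinForm.baseChange_tmul]
  rw [Algebra.smul_def, mul_comm]

theorem separating_of_baseChange
    (h : ∀ X : K ⊗[k] 𝔤, (∀ Y, killingForm K (K ⊗[k] 𝔤) X Y = 0) → X = 0) (X : 𝔤)
    (hX : ∀ Y, killingForm k 𝔤 X Y = 0) : X = 0 := by
  have h1 : (1 : K) ⊗ₜ[k] X = 0 := by
    refine h _ fun Y => ?_
    induction Y with
    | zero => simp
    | add Y Y' hY hY' => rw [map_add, hY, hY', add_zero]
    | tmul s Y => rw [killingForm_tmul, hX, map_zero, mul_zero]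
  exact Module.FaithfullyFlat.tensorProduct_mk_injective (A := k) (B := K) 𝔤 (by simpa using h1)

theorem baseChange_S (X Y : 𝔤) : (S k c X Y).baseChange K =
    S K (algebraMap k K c) ((1 : K) ⊗ₜ[k] X) ((1 : K) ⊗ₜ[k] Y) := by
  have hs (a : k) (Z : 𝔤) : (1 : K) ⊗ₜ[k] (a • Z) = algebraMap k K a • ((1 : K) ⊗ₜ[k] Z) := by
    rw [TensorProduct.tmul_smul, algebraMap_smul]
  ext Z
  simp only [TensorProduct.AlgebraTensorModule.curry_apply, TensorProduct.curry_apply,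
    LinearMap.coe_restrictScalars, LinearMap.baseChange_tmul, S_apply,
    killingForm_tmul, TensorProduct.tmul_add, hs, LieAlgebra.ExtendScalars.bracket_tmul, one_mul,
    map_div₀, map_inv₀, map_ofNat]

theorem baseChange_adEnd (X : 𝔤) (T : Module.End k 𝔤) : (adEnd k X T).baseChange K =
    adEnd K ((1 : K) ⊗ₜ[k] X) (T.baseChange K) := by
  ext Z
  simp [adEnd]

theorem baseChange_prodAux (X Y : 𝔤) (T : Module.End k 𝔤) : (prodAux k c X Y T).baseChange K =
    prodAux K (algebraMap k K c) ((1 : K) ⊗ₜ[k] X) ((1 : K) ⊗ₜ[k] Y) (T.baseChange K) := by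
  have hs (a : k) (T : Module.End k 𝔤) :
      (a • T).baseChange K = algebraMap k K a • T.baseChange K := by
    rw [LinearMap.baseChange_smul, algebraMap_smul]
  simp only [prodAux, LinearMap.coe_mk, AddHom.coe_mk, LinearMap.baseChange_add, hs, baseChange_S,
    baseChange_adEnd, LinearMap.baseChange_tmul, map_div₀, map_inv₀, map_ofNat]

theorem baseChange_mem_algA {T : Module.End k 𝔤} (hT : T ∈ algA k 𝔤 c) :
    T.baseChange K ∈ algA K (K ⊗[k] 𝔤) (algebraMap k K c) := by
  obtain ⟨a, rfl⟩ : ∃ a : algA k 𝔤 c, (a : Module.End k 𝔤) = T := ⟨⟨T, hT⟩, rfl⟩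
  induction a using algA_induction with
  | hS X Y => rw [coe_SAₗ, baseChange_S]; exact (SAₗ _ _ _).2
  | hadd a b ha hb =>
    rw [Submodule.coe_add, LinearMap.baseChange_add]
    exact add_mem (ha a.2) (hb b.2)

variable (𝔤) in
/-- The extension of scalars `A(𝔤) → A(K ⊗ 𝔤)`. -/
def algBaseChange : algA k 𝔤 c →+ algA K (K ⊗[k] 𝔤) (algebraMap k K c) where
  toFun a := ⟨(a : Module.End k 𝔤).baseChange K, baseChange_mem_algA K c a.2⟩
  map_zero' := Subtype.ext (by simp)
  map_add' a b := Subtype.ext (by simp)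

theorem algBaseChange_smul (r : k) (a : algA k 𝔤 c) :
    algBaseChange 𝔤 K c (r • a) = algebraMap k K r • algBaseChange 𝔤 K c a :=
  Subtype.ext (by
    change ((r • a : algA k 𝔤 c) : Module.End k 𝔤).baseChange K = _
    rw [Submodule.coe_smul, LinearMap.baseChange_smul, Submodule.coe_smul, algebraMap_smul]
    rfl)

theorem algBaseChange_SAₗ (X Y : 𝔤) : algBaseChange 𝔤 K c (SAₗ c X Y) =
    SAₗ (algebraMap k K c) ((1 : K) ⊗ₜ[k] X) ((1 : K) ⊗ₜ[k] Y) :=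
  Subtype.ext (baseChange_S K c X Y)

theorem algBaseChange_algMul (a b : algA k 𝔤 c) : algBaseChange 𝔤 K c (algMul k 𝔤 c a b) =
    algMul K (K ⊗[k] 𝔤) (algebraMap k K c) (algBaseChange 𝔤 K c a) (algBaseChange 𝔤 K c b) := by
  induction a using algA_induction with
  | hS X Y =>
    apply Subtype.ext
    rw [algBaseChange_SAₗ, coe_algMul_S]
    change (algMul k 𝔤 c (SAₗ c X Y) b : Module.End k 𝔤).baseChange K = _
    rw [coe_algMul_S, baseChange_prodAux]
    rfl
  | hadd a a' ha ha' => simp only [map_add, LinearMap.add_apply, ha, ha']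

theorem algCounit_algBaseChange (a : algA k 𝔤 c) :
    algCounit K (K ⊗[k] 𝔤) (algebraMap k K c) (algBaseChange 𝔤 K c a) =
      algebraMap k K (algCounit k 𝔤 c a) := by
  change (Module.finrank K (K ⊗[k] 𝔤) : K)⁻¹ *
    LinearMap.trace K (K ⊗[k] 𝔤) ((a : Module.End k 𝔤).baseChange K) = _
  rw [LinearMap.trace_baseChange, Module.finrank_baseChange]
  simp [algCounit]

theorem algBaseChange_one (he : (1 : Module.End k 𝔤) ∈ algA k 𝔤 c)
    (he' : (1 : Module.End K (K ⊗[k] 𝔤)) ∈ algA K (K ⊗[k] 𝔤) (algebraMap k K c)) :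
    algBaseChange 𝔤 K c ⟨1, he⟩ = ⟨1, he'⟩ :=
  Subtype.ext (LinearMap.baseChange_one ..)

theorem span_range_algBaseChange :
    Submodule.span K (Set.range (algBaseChange 𝔤 K c)) = ⊤ := by
  rw [eq_top_iff]
  rintro a -
  induction a using algA_induction with
  | hadd a b ha hb => exact add_mem ha hb
  | hS U V =>
    induction U with
    | zero => simp
    | add U U' hU hU' => rw [map_add, LinearMap.add_apply]; exact add_mem hU hU'
    | tmul r X =>
      induction V with
      | zero => simp
      | add V V' hV hV' => rw [map_add]; exact add_mem hV hV'
      | tmul s Y =>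
        have hr (r : K) (X : 𝔤) : r ⊗ₜ[k] X = r • ((1 : K) ⊗ₜ[k] X) := by
          rw [TensorProduct.smul_tmul', smul_eq_mul, mul_one]
        rw [hr r, hr s, map_smul, map_smul, LinearMap.smul_apply, ← algBaseChange_SAₗ]
        exact Submodule.smul_mem _ _ (Submodule.smul_mem _ _ (Submodule.subset_span ⟨_, rfl⟩))

variable (𝔤) in
/-- The image of the kernel of the counit under extension of scalars. -/
def kerBaseChange : AddSubmonoid (algA K (K ⊗[k] 𝔤) (algebraMap k K c)) :=
  (LinearMap.ker (algCounit k 𝔤 c)).toAddSubmonoid.map (algBaseChange 𝔤 K c)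

/-- The projection `x ↦ x - ε(x) e` is linear, fixes the kernel, and sends the image of `A(𝔤)`,
which spans, into the image of the kernel over `k`. -/
theorem mem_span_kerBaseChange (he : (1 : Module.End k 𝔤) ∈ algA k 𝔤 c)
    (hε : algCounit k 𝔤 c ⟨1, he⟩ = 1) {x : algA K (K ⊗[k] 𝔤) (algebraMap k K c)}
    (hx : algCounit K (K ⊗[k] 𝔤) (algebraMap k K c) x = 0) :
    x ∈ Submodule.span K (kerBaseChange 𝔤 K c : Set (algA K (K ⊗[k] 𝔤) (algebraMap k K c))) := by
  set e := algBaseChange 𝔤 K c ⟨1, he⟩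
  set ε := algCounit K (K ⊗[k] 𝔤) (algebraMap k K c)
  suffices h : x - ε x • e ∈ Submodule.span K
      (kerBaseChange 𝔤 K c : Set (algA K (K ⊗[k] 𝔤) (algebraMap k K c))) by
    rwa [hx, zero_smul, sub_zero] at h
  have hx' : x ∈ Submodule.span K (Set.range (algBaseChange 𝔤 K c)) := by
    rw [span_range_algBaseChange]; trivial
  clear hx
  induction hx' using Submodule.span_induction with
  | mem x h =>
    obtain ⟨a, rfl⟩ := h
    refine Submodule.subset_span ⟨a - algCounit k 𝔤 c a • ⟨1, he⟩, ?_, ?_⟩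
    · change algCounit k 𝔤 c _ = 0
      rw [map_sub, map_smul, hε, smul_eq_mul, mul_one, sub_self]
    · rw [map_sub, algBaseChange_smul]
      rw [algCounit_algBaseChange]
  | zero => simp
  | add x y _ _ hx hy =>
    have := add_mem hx hy
    rwa [show x - ε x • e + (y - ε y • e) = x + y - ε (x + y) • e by rw [map_add]; module] at this
  | smul r x _ hx =>
    have := Submodule.smul_mem _ r hx
    rwa [show r • (x - ε x • e) = r • x - ε (r • x) • e by
      rw [map_smul, smul_eq_mul]; module] at this

theorem symmetrize_powerDefect_baseChange (c₀ : k) (he : (1 : Module.End k 𝔤) ∈ algA k 𝔤 c)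
    (hε : algCounit k 𝔤 c ⟨1, he⟩ = 1)
    (he' : (1 : Module.End K (K ⊗[k] 𝔤)) ∈ algA K (K ⊗[k] 𝔤) (algebraMap k K c))
    (h : ∀ v, algCounit k 𝔤 c v = 0 → powerDefect
      (reducedMul (algMul k 𝔤 c) ⟨1, he⟩ (algCounit k 𝔤 c))
      ((algMul k 𝔤 c).compr₂ (algCounit k 𝔤 c)) c₀ v v v v = 0)
    {x y z w : algA K (K ⊗[k] 𝔤) (algebraMap k K c)}
    (hx : algCounit K (K ⊗[k] 𝔤) (algebraMap k K c) x = 0)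
    (hy : algCounit K (K ⊗[k] 𝔤) (algebraMap k K c) y = 0)
    (hz : algCounit K (K ⊗[k] 𝔤) (algebraMap k K c) z = 0)
    (hw : algCounit K (K ⊗[k] 𝔤) (algebraMap k K c) w = 0) :
    symmetrize (powerDefect
      (reducedMul (algMul K (K ⊗[k] 𝔤) (algebraMap k K c)) ⟨1, he'⟩
        (algCounit K (K ⊗[k] 𝔤) (algebraMap k K c)))
      ((algMul K (K ⊗[k] 𝔤) (algebraMap k K c)).compr₂
        (algCounit K (K ⊗[k] 𝔤) (algebraMap k K c))) (algebraMap k K c₀)) x y z w = 0 := by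
  have hm (a b : algA k 𝔤 c) : reducedMul (algMul K (K ⊗[k] 𝔤) (algebraMap k K c)) ⟨1, he'⟩
      (algCounit K (K ⊗[k] 𝔤) (algebraMap k K c)) (algBaseChange 𝔤 K c a) (algBaseChange 𝔤 K c b)
      = algBaseChange 𝔤 K c (reducedMul (algMul k 𝔤 c) ⟨1, he⟩ (algCounit k 𝔤 c) a b) := by
    rw [reducedMul_apply, reducedMul_apply, map_sub, algBaseChange_smul, algBaseChange_algMul,
      ← algCounit_algBaseChange, algBaseChange_algMul, algBaseChange_one K c he he']
  have hf (a b : algA k 𝔤 c) : (algMul K (K ⊗[k] 𝔤) (algebraMap k K c)).compr₂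
      (algCounit K (K ⊗[k] 𝔤) (algebraMap k K c)) (algBaseChange 𝔤 K c a) (algBaseChange 𝔤 K c b)
      = algebraMap k K ((algMul k 𝔤 c).compr₂ (algCounit k 𝔤 c) a b) := by
    rw [LinearMap.compr₂_apply, LinearMap.compr₂_apply, ← algCounit_algBaseChange,
      algBaseChange_algMul]
  refine symmetrize_powerDefect_eq_zero_of_span _ _ _ (kerBaseChange 𝔤 K c) ?_
    (mem_span_kerBaseChange K c he hε hx) (mem_span_kerBaseChange K c he hε hy)
    (mem_span_kerBaseChange K c he hε hz) (mem_span_kerBaseChange K c he hε hw)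
  rintro _ ⟨v, hv, rfl⟩
  have h' := congrArg (algBaseChange 𝔤 K c) (h v hv)
  rw [map_zero] at h'
  rw [← h']
  simp only [powerDefect, hm, hf, map_sub, algBaseChange_smul]

end BaseChange

/-! ### From power-associativity to the fourth power identity. -/

section PowerAssociative

variable {k V : Type*} [Field k] [AddCommGroup V] [Module k V]

theorem IsPowerAssociative.sq_mul_sq {m : V →ₗ[k] V →ₗ[k] V} (h : IsPowerAssociative m) (a : V) :
    m (m a a) (m a a) = m (m (m a a) a) a := by
  have ha : a ∈ generatedSubalgebra m a := Submodule.mem_sInf.mpr fun B hB => hB.1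
  have haa : m a a ∈ generatedSubalgebra m a :=
    Submodule.mem_sInf.mpr fun B hB => hB.2 a hB.1 a hB.1
  exact (h a _ haa a ha a ha).symm

variable {m : V →ₗ[k] V →ₗ[k] V} {e : V} {ε : V →ₗ[k] k} {hε : ε e = 1}

theorem coe_kerMul (v w : LinearMap.ker ε) : (kerMul m e ε hε v w : V) = reducedMul m e ε v w := by
  rw [reducedMul_apply]; rfl

theorem powerDefect_eq_zero_of_kerMul (h : IsPowerAssociative (kerMul m e ε hε)) {v : V}
    (hv : ε v = 0) : powerDefect (reducedMul m e ε) (m.compr₂ ε) 0 v v v v = 0 := by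
  have h1 := congrArg Subtype.val (h.sq_mul_sq ⟨v, hv⟩)
  simp only [coe_kerMul] at h1
  rw [powerDefect, h1, zero_smul, sub_self, sub_zero]

/-- Take the second component of the identity at `(0, v)`: the scalar `c f(v, v)` contributes two
copies of `v · v` to `v² v²` but one to `(v² v) v`, which also contains `c f(v · v, v) v`. -/
theorem powerDefect_eq_zero_of_unitMul {c : k}
    (h : IsPowerAssociative (unitMul (kerMul m e ε hε) (c • kerForm m ε))) {v : V}
    (hv : ε v = 0) : powerDefect (reducedMul m e ε) (m.compr₂ ε) c v v v v = 0 := by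
  have hu (x y : k × LinearMap.ker ε) : unitMul (kerMul m e ε hε) (c • kerForm m ε) x y =
    (x.1 * y.1 + c * m.compr₂ ε x.2 y.2, x.1 • y.2 + y.1 • x.2 + kerMul m e ε hε x.2 y.2) := rfl
  have h1 := congrArg (fun x => (x.2 : V)) (h.sq_mul_sq (0, ⟨v, hv⟩))
  simp only [hu, coe_kerMul, Submodule.coe_add, Submodule.coe_smul, zero_smul, mul_zero,
    zero_add, add_zero] at h1
  rw [powerDefect]
  rw [← sub_eq_zero, map_add, map_smul, LinearMap.add_apply, LinearMap.smul_apply] at h1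
  rw [← h1]
  module

end PowerAssociative

end ChayetGaribaldi
end
-- The main theorem.
open ChayetGaribaldi
theorem mainTheorem7 {k 𝔤 : Type*} [Field k] [LieRing 𝔤] [LieAlgebra k 𝔤] [FiniteDimensional k 𝔤]
    {ι M N : Type*} [Finite ι] [AddCommGroup M] [Module ℚ M] [AddCommGroup N] [Module ℚ N]
    (P : RootPairing ι ℚ M N) [P.IsRootSystem] [P.IsCrystallographic] [P.IsReduced]
    [P.IsIrreducible] (b : P.Base) (θ : ι) (hθ : IsHighestRoot b θ)
    (h𝔤 : IsAbsolutelyOfType b k 𝔤)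
    (hk : ringChar k = 0 ∨ coxeterNumber P + 2 ≤ ringChar k)
    (hA₁ : ¬ IsTypeA b 1) (hA₂ : ¬ IsTypeA b 2)
    (hv : k) (h_hv : hv = dualCoxeterNumber b θ) :
    ∃ (he : (1 : Module.End k 𝔤) ∈ algA k 𝔤 hv) (hε : algCounit k 𝔤 hv ⟨1, he⟩ = 1),
      (∀ a, algMul k 𝔤 hv ⟨1, he⟩ a = a ∧ algMul k 𝔤 hv a ⟨1, he⟩ = a) ∧
      kerMul (algMul k 𝔤 hv) ⟨1, he⟩ (algCounit k 𝔤 hv) hε ≠ 0 ∧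
      ¬ IsPowerAssociative (kerMul (algMul k 𝔤 hv) ⟨1, he⟩ (algCounit k 𝔤 hv) hε) ∧
      ∀ c : k, ¬ IsPowerAssociative
        (unitMul (kerMul (algMul k 𝔤 hv) ⟨1, he⟩ (algCounit k 𝔤 hv) hε)
          (c • kerForm (algMul k 𝔤 hv) (algCounit k 𝔤 hv))) := by
  have := Fintype.ofFinite ι
  obtain ⟨B⟩ := h𝔤
  have hD := dualCoxeterNumber_le hθ
  have hD' := card_support_lt_dualCoxeterNumber hθ
  have hr := two_le_card_support hA₁
  have hfin := B.finrank_eq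
  rw [Module.finrank_baseChange] at hfin
  obtain ⟨d, hd⟩ := Int.eq_ofNat_of_zero_le (a := dualCoxeterNumber b θ) (by lia)
  rw [hd] at hD hD' h_hv
  -- All the integers needed are at most `h + 1`: with `d = h^∨` one has `3 ≤ rank + 1 ≤ d ≤ h`, and
  -- `dim 𝔤 = rank · (h + 1)` has both factors in this range.
  have hn (n : ℕ) (h0 : n ≠ 0) (hn : n < coxeterNumber P + 2) : (n : k) ≠ 0 :=
    natCast_ne_zero_of_ringChar hk h0 hn
  have h2 : (2 : k) ≠ 0 := hn 2 (by lia) (by lia)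
  have h3 : (3 : k) ≠ 0 := hn 3 (by lia) (by lia)
  have hd0 : (d : k) ≠ 0 := hn d (by lia) (by lia)
  have hd1 : (d : k) + 1 ≠ 0 := by exact_mod_cast hn (d + 1) (by lia) (by lia)
  have hh : (coxeterNumber P : k) ≠ 0 := hn _ (by lia) (by lia)
  have hdim : (Module.finrank k 𝔤 : k) ≠ 0 := by
    rw [hfin, Nat.cast_mul]
    exact mul_ne_zero (hn _ (by lia) (by lia)) (hn _ (by lia) (by lia))
  rw [Int.cast_natCast] at h_hv
  rw [← h_hv] at hd0 hd1
  have hmap {x : k} (hx : x ≠ 0) : algebraMap k (AlgebraicClosure k) x ≠ 0 :=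
    (map_ne_zero _).mpr hx
  have h2' : (2 : AlgebraicClosure k) ≠ 0 := by rw [← map_ofNat (algebraMap k _)]; exact hmap h2
  have h3' : (3 : AlgebraicClosure k) ≠ 0 := by rw [← map_ofNat (algebraMap k _)]; exact hmap h3
  have hhv : algebraMap k (AlgebraicClosure k) hv = dualCoxeterNumber b θ := by
    rw [hd, h_hv]; simp
  have hh' : (coxeterNumber P : AlgebraicClosure k) ≠ 0 := by simpa using hmap hh
  have hdim' : (Module.finrank (AlgebraicClosure k) (AlgebraicClosure k ⊗[k] 𝔤) :
      AlgebraicClosure k) ≠ 0 := by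
    rw [Module.finrank_baseChange]; simpa using hmap hdim
  have hd1' : algebraMap k (AlgebraicClosure k) hv + 1 ≠ 0 := by simpa using hmap hd1
  have hsep (X : AlgebraicClosure k ⊗[k] 𝔤) := B.killingForm_separating h2' h3' hθ
    (by rw [← hhv]; exact hmap hd0) hh' (X := X)
  obtain ⟨he, hunit⟩ := exists_one_mem_algA h2
    (separating_of_baseChange (k := k) (𝔤 := 𝔤) _ hsep) hd1
  obtain ⟨he', hunit'⟩ := exists_one_mem_algA h2' hsep hd1'
  have hε := algCounit_one hdim he
  have key (c₀ : k) (h : ∀ v, algCounit k 𝔤 hv v = 0 → powerDefect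
      (reducedMul (algMul k 𝔤 hv) ⟨1, he⟩ (algCounit k 𝔤 hv))
      ((algMul k 𝔤 hv).compr₂ (algCounit k 𝔤 hv)) c₀ v v v v = 0) : False :=
    B.not_forall_symmetrize_eq_zero h2' h3' hθ hA₁ hA₂ hhv (hmap hd0) hd1' hdim' he' hunit'
      (algCounit_one hdim' he') _ fun _ _ _ _ hx hy hz hw =>
        symmetrize_powerDefect_baseChange (AlgebraicClosure k) hv c₀ he hε he' h hx hy hz hw
  have hpow : ¬ IsPowerAssociative (kerMul (algMul k 𝔤 hv) ⟨1, he⟩ (algCounit k 𝔤 hv) hε) :=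
    fun h => key 0 fun v hv => powerDefect_eq_zero_of_kerMul h hv
  -- The product on `V` cannot vanish, since a zero product is associative and hence
  -- power-associative.
  refine ⟨he, hε, fun a => ⟨hunit a, by rw [algMul_comm, hunit a]⟩, fun h => hpow ?_, hpow,
    fun c h => key c fun v hv => powerDefect_eq_zero_of_unitMul h hv⟩
  rw [h]
  intro a x _ y _ z _
  simp
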